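/- Let $\mathsf G=(\mathsf V,\mathsf E)$ be a countable, connected, locally finite undirected graph with path distance $\rho$ and degrees $n(x)$, fix a root $o\in\mathsf V$, and put $w_\alpha(x)=e^{-\alpha\rho(o,x)}$. Let $\theta>0$ be such that $$\Theta(\alpha,\theta)=\sum_{x\in\mathsf V}\ \sum_{y\sim x}[n(x)n(y)]^{\theta}\,w_\alpha(x)<\infty\quad\text{for some }\alpha>0 .$$ Put $\underline\alpha=\inf\{\alpha>0:\Theta(\alpha,\theta)<\infty\}$ and let $\overline\alpha>\underline\alpha$ be such that $\Theta(\alpha,\theta)<\infty$ for all $\alpha\in(\underline\alpha,\overline\alpha]$. Let $r>0$ and let $W:\mathbb R\times\mathbb R\to\mathbb R$ be continuous and symmetric with $|W(u,v)|\le\frac12[I_W+J_W(|u|^r+|v|^r)]$ for all $u,v$, where $I_W,J_W>0$. Put $p_0=r+r/\theta$, let $q>p_0$, and let $V:\mathbb R\to\mathbb R$ be continuous with $V(u)\ge a_V|u|^q-c_V$ for all $u$, where $a_V,c_V>0$. Let $\Omega=\mathbb R^{\mathsf V}$ with the product topology and its Borel $\sigma$-field. For finite non-empty $\Lambda\subset\mathsf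 V$, $\xi\in\Omega$ and Borel $A\subset\Omega$ let $$\pi_\Lambda(A|\xi)=\frac1{Z_\Lambda(\xi)}\int_{\mathbb R^\Lambda}\mathbb I_A(\omega_\Lambda\times\xi_{\Lambda^c})\,e^{-H_\Lambda(\omega_\Lambda|\xi)}\,d\omega_\Lambda ,$$ $$H_\Lambda(\omega_\Lambda|\xi)=\sum_{\langle x,y\rangle:\,x,y\in\Lambda}W(\omega(x),\omega(y))+\sum_{\langle x,y\rangle:\,x\in\Lambda,\,y\in\Lambda^c}W(\omega(x),\xi(y))+\sum_{x\in\Lambda}V(\omega(x)),$$ where the first two sums are over edges, $d\omega_\Lambda$ is Lebesgue measure, and $Z_\Lambda(\xi)$ is the normalizing factor. A Borel probability measure $\mu$ on $\Omega$ is a Gibbs measure if $\mu(A)=\int_\Omega\pi_\Lambda(A|\omega)\,\mu(d\omega)$ for all Borel $A$ and all finite non-empty $\Lambda$. Let $L^p(\mathsf V,w_\alpha)=\{\omega\in\Omega:\|\omega\|_{p,\alpha}<\infty\}$ with $\|\omega\|_{p,\alpha}=\big[\sum_x|\omega(x)|^pw_\alpha(x)\big]^{1/p}$, equipped with the topology of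 $\|\cdot\|_{p,\alpha}$ (a norm if $p\ge1$, a quasi-norm if $p<1$), and let $$\widetilde\Omega^{\rm t}=\bigcap_{p\in[p_0,q)}\ \bigcap_{\alpha\in(\underline\alpha,\overline\alpha]}L^p(\mathsf V,w_\alpha)$$ with the projective limit topology, that is, the coarsest topology for which all the inclusions $\widetilde\Omega^{\rm t}\to L^p(\mathsf V,w_\alpha)$ are continuous. Let $\widetilde{\mathcal G}^{\rm t}$ be the set of all Gibbs measures $\mu$ with $\mu(\widetilde\Omega^{\rm t})=1$, regarded as Borel probability measures on $\widetilde\Omega^{\rm t}$ (the Borel sets of $\widetilde\Omega^{\rm t}$ are the sets $A\cap\widetilde\Omega^{\rm t}$ with $A\subset\Omega$ Borel). Then $\widetilde{\mathcal G}^{\rm t}$ is non-empty, and it is compact in the weak topology on the set of all Borel probability measures on $\widetilde\Omega^{\rm t}$. -/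

import Mathlib

open MeasureTheory
open scoped ENNReal

noncomputable section

namespace GibbsGraph

universe u

/-! ### Weights on a locally finite graph -/

/-- The weight `w_α(x) = exp(-α ρ(o, x))`, where `ρ` is the path distance and `o` is the root. -/
def weight {X : Type u} (G : SimpleGraph X) (o : X) (α : ℝ) (x : X) : ℝ :=
  Real.exp (-α * (G.dist o x : ℝ))

/-- `m_θ(x) = ∑_{y ∼ x} [n(x) n(y)]^θ`, where `n` is the degree. -/
def degreeSum {X : Type u} (G : SimpleGraph X) [G.LocallyFinite] (θ : ℝ) (x : X) : ℝ :=
  ∑ y ∈ G.neighborFinset x, ((G.degree x : ℝ) * (G.degree y : ℝ)) ^ θ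

/-- `Θ(α, θ) = ∑_x m_θ(x) w_α(x)`, with values in `[0, ∞]`. -/
def bigTheta {X : Type u} (G : SimpleGraph X) [G.LocallyFinite] (o : X) (α θ : ℝ) : ℝ≥0∞ :=
  ∑' x, ENNReal.ofReal (degreeSum G θ x * weight G o α x)

/-- The infimum of all positive `α` with `Θ(α, θ) < ∞`. -/
def alphaLower {X : Type u} (G : SimpleGraph X) [G.LocallyFinite] (o : X) (θ : ℝ) : ℝ :=
  sInf {α : ℝ | 0 < α ∧ bigTheta G o α θ < ∞}

/-! ### The local Gibbs specification and Gibbs measures -/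

open Classical in
/-- The configuration `u × ξ_{Λᶜ}`: equal to `u` on `Λ` and to `ξ` off `Λ`. -/
def glue {X : Type u} (Λ : Finset X) (u : Λ → ℝ) (ξ : X → ℝ) : X → ℝ :=
  fun x => if h : x ∈ Λ then u ⟨x, h⟩ else ξ x

open Classical in
/-- The relative local Hamiltonian `H_Λ(u | ξ)`. In the first sum every edge inside `Λ` is met
twice, once for each order of its endpoints, hence the factor `1/2` (`W` is symmetric). In the
second sum every edge between `Λ` and its complement is met once. -/
def localHamiltonian {X : Type u} (G : SimpleGraph X) [G.LocallyFinite] (W : ℝ → ℝ → ℝ)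
    (V : ℝ → ℝ) (Λ : Finset X) (u : Λ → ℝ) (ξ : X → ℝ) : ℝ :=
  (1 / 2 : ℝ) * (∑ x ∈ Λ, ∑ y ∈ (G.neighborFinset x).filter (fun y => y ∈ Λ),
      W (glue Λ u ξ x) (glue Λ u ξ y))
    + (∑ x ∈ Λ, ∑ y ∈ (G.neighborFinset x).filter (fun y => y ∉ Λ), W (glue Λ u ξ x) (ξ y))
    + ∑ x ∈ Λ, V (glue Λ u ξ x)

/-- The normalizing factor `Z_Λ(ξ)`, an integral with respect to Lebesgue measure on `ℝ^Λ`. -/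
def partitionFunction {X : Type u} (G : SimpleGraph X) [G.LocallyFinite] (W : ℝ → ℝ → ℝ)
    (V : ℝ → ℝ) (Λ : Finset X) (ξ : X → ℝ) : ℝ≥0∞ :=
  ∫⁻ u : Λ → ℝ, ENNReal.ofReal (Real.exp (-localHamiltonian G W V Λ u ξ))

/-- The measure `π_Λ(· | ξ)`: the law of `u × ξ_{Λᶜ}`, where `u` has the density
`exp(-H_Λ(u | ξ)) / Z_Λ(ξ)` with respect to Lebesgue measure on `ℝ^Λ`. -/
def gibbsSpec {X : Type u} (G : SimpleGraph X) [G.LocallyFinite] (W : ℝ → ℝ → ℝ)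
    (V : ℝ → ℝ) (Λ : Finset X) (ξ : X → ℝ) : Measure (X → ℝ) :=
  (partitionFunction G W V Λ ξ)⁻¹ •
    Measure.map (fun u : Λ → ℝ => glue Λ u ξ)
      ((volume : Measure (Λ → ℝ)).withDensity
        fun u => ENNReal.ofReal (Real.exp (-localHamiltonian G W V Λ u ξ)))

/-- The DLR equation: `μ(A) = ∫ π_Λ(A | ω) μ(dω)` for all measurable `A` and all finite
non-empty sets `Λ` of vertices. -/
def IsGibbs {X : Type u} (G : SimpleGraph X) [G.LocallyFinite] (W : ℝ → ℝ → ℝ)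
    (V : ℝ → ℝ) (μ : ProbabilityMeasure (X → ℝ)) : Prop :=
  ∀ A : Set (X → ℝ), MeasurableSet A → ∀ Λ : Finset X, Λ.Nonempty →
    (μ : Measure (X → ℝ)) A = ∫⁻ ω, gibbsSpec G W V Λ ω A ∂(μ : Measure (X → ℝ))

/-! ### Weighted `L^p` spaces and tempered configurations -/

/-- `‖ω‖_{p,α} = [∑_x |ω(x)|^p w_α(x)]^{1/p}`, used only where the series converges. -/
def lpNorm {X : Type u} (G : SimpleGraph X) (o : X) (p α : ℝ) (ω : X → ℝ) : ℝ :=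
  (∑' x, |ω x| ^ p * weight G o α x) ^ (1 / p)

/-- The set of the configurations `ω` with `‖ω‖_{p,α} < ∞`. -/
def lpSet {X : Type u} (G : SimpleGraph X) (o : X) (p α : ℝ) : Set (X → ℝ) :=
  {ω | Summable fun x => |ω x| ^ p * weight G o α x}

/-- The space `L^p(X, w_α)`, as a type of its own, so that it carries the topology below and not
that of pointwise convergence. -/
def LpSpace {X : Type u} (G : SimpleGraph X) (o : X) (p α : ℝ) : Type u :=
  {ω : X → ℝ // ω ∈ lpSet G o p α}

/-- The topology of `L^p(X, w_α)`, generated by the balls of `‖·‖_{p,α}`. For `p ≥ 1` it is the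
norm topology; for `0 < p < 1` it is the topology of the metric `‖ω - η‖_{p,α}^p`, which has the
same balls up to the change of the radius. -/
instance {X : Type u} (G : SimpleGraph X) (o : X) (p α : ℝ) :
    TopologicalSpace (LpSpace G o p α) :=
  TopologicalSpace.generateFrom
    {B | ∃ (η : LpSpace G o p α) (ε : ℝ), 0 < ε ∧
      B = {ω : LpSpace G o p α | lpNorm G o p α (ω.1 - η.1) < ε}}

/-- The intersection of the sets `L^p(X, w_α)` over `p ∈ [p₀, q)` and `α ∈ (a, b]`. -/
def temperedSet {X : Type u} (G : SimpleGraph X) (o : X) (p₀ q a b : ℝ) : Set (X → ℝ) :=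
  ⋂ p ∈ Set.Ico p₀ q, ⋂ α ∈ Set.Ioc a b, lpSet G o p α

/-- The space of tempered configurations, as a type of its own. -/
def TemperedSpace {X : Type u} (G : SimpleGraph X) (o : X) (p₀ q a b : ℝ) : Type u :=
  {ω : X → ℝ // ω ∈ temperedSet G o p₀ q a b}

/-- The inclusion of the space of tempered configurations into `L^p(X, w_α)`. -/
def TemperedSpace.toLp {X : Type u} {G : SimpleGraph X} {o : X} {p₀ q a b : ℝ}
    (p : Set.Ico p₀ q) (α : Set.Ioc a b) (ω : TemperedSpace G o p₀ q a b) :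
    LpSpace G o p α :=
  ⟨ω.1, Set.mem_iInter₂.1 (Set.mem_iInter₂.1 ω.2 p.1 p.2) α.1 α.2⟩

/-- The projective limit topology: the coarsest one for which all the inclusions into the spaces
`L^p(X, w_α)`, `p ∈ [p₀, q)`, `α ∈ (a, b]`, are continuous. -/
instance {X : Type u} (G : SimpleGraph X) (o : X) (p₀ q a b : ℝ) :
    TopologicalSpace (TemperedSpace G o p₀ q a b) :=
  ⨅ (p : Set.Ico p₀ q) (α : Set.Ioc a b),
    TopologicalSpace.induced (TemperedSpace.toLp p α) inferInstance

/-- The Borel `σ`-field of the projective limit topology. -/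
instance {X : Type u} (G : SimpleGraph X) (o : X) (p₀ q a b : ℝ) :
    MeasurableSpace (TemperedSpace G o p₀ q a b) :=
  borel _

instance {X : Type u} (G : SimpleGraph X) (o : X) (p₀ q a b : ℝ) :
    BorelSpace (TemperedSpace G o p₀ q a b) :=
  ⟨rfl⟩

/-- The Gibbs measures `μ` on `ℝ^X` for which the set of tempered configurations has
measure `1`. -/
def temperedGibbs {X : Type u} (G : SimpleGraph X) [G.LocallyFinite] (o : X) (W : ℝ → ℝ → ℝ)
    (V : ℝ → ℝ) (p₀ q a b : ℝ) : Set (ProbabilityMeasure (X → ℝ)) :=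
  {μ | IsGibbs G W V μ ∧ (μ : Measure (X → ℝ)) (temperedSet G o p₀ q a b) = 1}

/-- The measures in `temperedGibbs`, regarded as Borel probability measures on the space of
tempered configurations: `ν` corresponds to `μ` when `ν(A ∩ TemperedSpace) = μ(A)` for all
measurable sets `A` of configurations. -/
def temperedGibbsOn {X : Type u} (G : SimpleGraph X) [G.LocallyFinite] (o : X)
    (W : ℝ → ℝ → ℝ) (V : ℝ → ℝ) (p₀ q a b : ℝ) :
    Set (ProbabilityMeasure (TemperedSpace G o p₀ q a b)) :=
  {ν | ∃ μ ∈ temperedGibbs G o W V p₀ q a b, ∀ A : Set (X → ℝ), MeasurableSet A →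
    (ν : Measure (TemperedSpace G o p₀ q a b)) {ω | ω.1 ∈ A} = (μ : Measure (X → ℝ)) A}

end GibbsGraph

end

/-! The engine is a moment estimate that is uniform over volumes and boundary conditions. For one
vertex, `s ≤ B + exp (s - B)` reduces the `p`-th moment of `π_x(· | ξ)` to a bound on its
logarithmic exponential moment, which is at most linear in `∑_{y ∼ x} |ξ(y)|^r`. Young's inequality
at scale `n(x) n(y)` turns this into `C (1 + m_θ(x)) + δ ∑_{y ∼ x} |ξ(y)|^p / (n(x) n(y))` with `δ`
as small as desired. Its error term carries the exponent `r / (p - r)`, which is at most `θ` exactly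
when `p ≥ r + r / θ`; hence the threshold `p₀`.

Consistency of the specification carries this estimate into any finite `Λ`. After summation against
`w_α`, the factors `1 / (n(x) n(y))` compensate the degrees, adjacent weights differ by at most `exp
α`, and for `δ = exp (-α) / 2` the neighbour term is at most half of the total. Absorbing it bounds
the moments inside `Λ` by a constant plus the boundary sum off `Λ`
(`exists_sum_lintegral_gibbsSpec_le`). For a tempered Gibbs measure that sum tends to zero almost
surely as `Λ` grows, so all these measures obey the same bounds
(`lintegral_lpModular_le_of_bind_eq`).

Countably many pairs `(p_j, α_j)`, with `p_j` increasing to `q` and `α_j` decreasing to the lower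
endpoint, suffice. Markov's inequality gives product-compact sets `K n` whose complements have mass
at most `u n → 0`, and tempered Gibbs measures are precisely the Gibbs measures with this property.
By Prokhorov's theorem and the Feller property (`isClosed_setOf_bind_eq`) they form a compact set
for weak convergence over the product topology. It is non-empty by compactness, as it is
approximated by the local measures with zero boundary condition.

It remains to refine the topology. On each `K n` some exponent above `p` is bounded, so `L^p` tails
are uniformly small and pointwise convergence implies tempered convergence. Tietze extension then
makes push-forward to the tempered space continuous on measures nearly carried by the `K n`, and a
continuous image of a compact set is compact. -/

namespace GibbsGraph

open Filter Topology

/-! ### Young-type inequalities and integrability of stretched exponentials -/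

/-- Young's inequality with an explicit scale `m`. -/
lemma exists_rpow_le_rpow_div_add {r p ε : ℝ} (hr : 0 < r) (hrp : r < p) (hε : 0 < ε) :
    ∃ C : ℝ, 0 ≤ C ∧ ∀ m : ℝ, 1 ≤ m → ∀ s : ℝ, 0 ≤ s →
      s ^ r ≤ ε * s ^ p / m + C * m ^ (r / (p - r)) := by
  refine ⟨(1 / ε) ^ (r / (p - r)), by positivity, fun m hm s hs => ?_⟩
  have hpr : 0 < p - r := by linarith
  have hm0 : 0 < m := by linarith
  have hC : 0 ≤ (1 / ε) ^ (r / (p - r)) * m ^ (r / (p - r)) := by positivity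
  -- Either `s ^ (p - r) ≥ m / ε` and the first term alone suffices, or `s ^ r < (m / ε) ^ (r / (p -
  -- r))`, which is the second term.
  rcases le_or_gt (m / ε) (s ^ (p - r)) with h | h
  · have hs0 : 0 < s := by
      rcases hs.eq_or_lt with rfl | h0
      · rw [Real.zero_rpow hpr.ne'] at h
        have : 0 < m / ε := by positivity
        linarith
      · exact h0
    have h1 : s ^ p = s ^ r * s ^ (p - r) := by
      rw [← Real.rpow_add hs0]; congr 1; ring
    have h2 : s ^ r ≤ ε * s ^ p / m := by
      rw [le_div_iff₀ hm0, h1]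
      have := mul_le_mul_of_nonneg_left h (Real.rpow_nonneg hs r)
      have h3 : s ^ r * m = ε * (s ^ r * (m / ε)) := by field_simp
      rw [h3]
      gcongr
    linarith
  · have h1 : s ^ r = (s ^ (p - r)) ^ (r / (p - r)) := by
      rw [← Real.rpow_mul hs]; congr 1; field_simp
    have h2 : s ^ r ≤ (1 / ε) ^ (r / (p - r)) * m ^ (r / (p - r)) := by
      rw [h1, ← Real.mul_rpow (by positivity) hm0.le]
      have : 1 / ε * m = m / ε := by ring
      rw [this]
      gcongr
    have : 0 ≤ ε * s ^ p / m := by positivity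
    linarith

lemma exists_rpow_le_mul_rpow_add {r p ε : ℝ} (hr : 0 < r) (hrp : r < p) (hε : 0 < ε) :
    ∃ C : ℝ, 0 ≤ C ∧ ∀ s : ℝ, 0 ≤ s → s ^ r ≤ ε * s ^ p + C := by
  obtain ⟨C, hC, h⟩ := exists_rpow_le_rpow_div_add hr hrp hε
  exact ⟨C, hC, fun s hs => by simpa using h 1 le_rfl s hs⟩

lemma integrable_exp_neg_mul_abs_rpow {q b : ℝ} (hq : 0 < q) (hb : 0 < b) :
    Integrable fun t : ℝ => Real.exp (-b * |t| ^ q) := by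
  -- The Bochner integral of a non-integrable function is `0`, so the positive Gamma-function value
  -- proves integrability.
  refine Integrable.of_integral_ne_zero ?_
  rw [integral_comp_abs (f := fun t => Real.exp (-b * t ^ q)), integral_exp_neg_mul_rpow hq hb]
  have : 0 < Real.Gamma (1 / q + 1) := Real.Gamma_pos_of_pos (by positivity)
  positivity

lemma integrable_exp_rpow_sub_rpow {p q a B : ℝ} (hp : 0 < p) (hpq : p < q) (ha : 0 < a)
    (hB : 0 ≤ B) : Integrable fun t : ℝ => Real.exp (B * |t| ^ p - a * |t| ^ q) := by
  have hq : 0 < q := hp.trans hpq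
  -- This `ε` makes `B * ε ≤ a / 2`, which leaves half of the decay; `B + 1` allows `B = 0`.
  obtain ⟨C, hC, h⟩ := exists_rpow_le_mul_rpow_add hp hpq (ε := a / (2 * (B + 1))) (by positivity)
  refine ((integrable_exp_neg_mul_abs_rpow hq (half_pos ha)).const_mul
    (Real.exp (B * C))).mono' ?_ (ae_of_all _ fun t => ?_)
  · have h1 : Continuous fun t : ℝ => |t| ^ p := continuous_abs.rpow_const fun _ => Or.inr hp.le
    have h2 : Continuous fun t : ℝ => |t| ^ q := continuous_abs.rpow_const fun _ => Or.inr hq.le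
    exact (Real.continuous_exp.comp (by fun_prop)).aestronglyMeasurable
  · rw [Real.norm_eq_abs, abs_of_pos (Real.exp_pos _), ← Real.exp_add]
    refine Real.exp_le_exp.2 ?_
    have h1 := mul_le_mul_of_nonneg_left (h |t| (abs_nonneg t)) hB
    have h2 : B * (a / (2 * (B + 1)) * |t| ^ q) ≤ a / 2 * |t| ^ q := by
      rw [← mul_assoc]
      gcongr
      rw [← mul_div_assoc, div_le_div_iff₀ (by positivity) (by positivity)]
      nlinarith
    nlinarith

/-! ### Marginals -/

section Marginal

variable {X : Type*}

open Classical in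
lemma glue_eq_updateFinset (Λ : Finset X) (u : Λ → ℝ) (ξ : X → ℝ) :
    glue Λ u ξ = Function.updateFinset ξ Λ u := by
  ext x
  simp [glue, Function.updateFinset]

lemma glue_of_mem {Λ : Finset X} (u : Λ → ℝ) (ξ : X → ℝ) {x : X} (h : x ∈ Λ) :
    glue Λ u ξ x = u ⟨x, h⟩ := by simp [glue, h]

lemma glue_of_notMem {Λ : Finset X} (u : Λ → ℝ) (ξ : X → ℝ) {x : X} (h : x ∉ Λ) :
    glue Λ u ξ x = ξ x := by simp [glue, h]

lemma glue_congr {Λ : Finset X} (u : Λ → ℝ) {ξ η : X → ℝ} (h : ∀ x ∉ Λ, ξ x = η x) :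
    glue Λ u ξ = glue Λ u η := by
  ext x
  by_cases hx : x ∈ Λ
  · simp [glue_of_mem, hx]
  · simp [glue_of_notMem, hx, h x hx]

@[fun_prop]
lemma continuous_glue (Λ : Finset X) :
    Continuous fun z : (Λ → ℝ) × (X → ℝ) => glue Λ z.1 z.2 := by
  refine continuous_pi fun x => ?_
  by_cases hx : x ∈ Λ
  · simp only [glue_of_mem _ _ hx]; fun_prop
  · simp only [glue_of_notMem _ _ hx]; fun_prop

lemma measurable_glue (Λ : Finset X) :
    Measurable fun z : (Λ → ℝ) × (X → ℝ) => glue Λ z.1 z.2 := by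
  refine measurable_pi_lambda _ fun x => ?_
  by_cases hx : x ∈ Λ
  · simp only [glue_of_mem _ _ hx]; fun_prop
  · simp only [glue_of_notMem _ _ hx]; fun_prop

lemma measurable_glue_left (Λ : Finset X) (ξ : X → ℝ) : Measurable fun u => glue Λ u ξ :=
  (measurable_glue Λ).comp (by fun_prop : Measurable fun u : Λ → ℝ => (u, ξ))

/-- The integral of `f` over the coordinates in `Λ` with respect to Lebesgue measure. -/
noncomputable def marg (Λ : Finset X) (f : (X → ℝ) → ℝ≥0∞) (ξ : X → ℝ) : ℝ≥0∞ :=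
  ∫⁻ u : Λ → ℝ, f (glue Λ u ξ)

open Classical in
lemma marg_eq_lmarginal (Λ : Finset X) (f : (X → ℝ) → ℝ≥0∞) :
    marg Λ f = lmarginal (fun _ => (volume : Measure ℝ)) Λ f := by
  ext ξ
  simp only [marg, lmarginal, glue_eq_updateFinset, volume_pi]

lemma measurable_marg (Λ : Finset X) {f : (X → ℝ) → ℝ≥0∞} (hf : Measurable f) :
    Measurable (marg Λ f) := by
  classical
  rw [marg_eq_lmarginal]
  exact hf.lmarginal _

lemma marg_union {Λ Δ : Finset X} [DecidableEq X] (h : Disjoint Λ Δ) {f : (X → ℝ) → ℝ≥0∞}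
    (hf : Measurable f) : marg (Λ ∪ Δ) f = marg Λ (marg Δ f) := by
  simp only [marg_eq_lmarginal]
  convert lmarginal_union (fun _ => (volume : Measure ℝ)) f hf h

lemma marg_congr {Λ : Finset X} (f : (X → ℝ) → ℝ≥0∞) {ξ η : X → ℝ} (h : ∀ x ∉ Λ, ξ x = η x) :
    marg Λ f ξ = marg Λ f η := by
  simp only [marg, glue_congr _ h]

lemma marg_glue {Λ : Finset X} (f : (X → ℝ) → ℝ≥0∞) (u : Λ → ℝ) (ξ : X → ℝ) :
    marg Λ f (glue Λ u ξ) = marg Λ f ξ :=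
  marg_congr f fun _ hx => glue_of_notMem u ξ hx

lemma marg_mul_left {Λ : Finset X} {f g : (X → ℝ) → ℝ≥0∞} (hf : Measurable f)
    (hg : ∀ u ξ, g (glue Λ u ξ) = g ξ) (ξ : X → ℝ) :
    marg Λ (fun ω => g ω * f ω) ξ = g ξ * marg Λ f ξ := by
  simp only [marg, hg]
  exact lintegral_const_mul _ (hf.comp (measurable_glue_left Λ ξ))

open Classical in
lemma marg_singleton (x : X) (f : (X → ℝ) → ℝ≥0∞) (ξ : X → ℝ) :
    marg {x} f ξ = ∫⁻ t : ℝ, f (Function.update ξ x t) := by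
  rw [marg_eq_lmarginal, lmarginal_singleton]

end Marginal

/-! ### Energy of a configuration in a finite volume -/

/-- The growth and continuity assumptions on the pair potential `W` and the self-potential `V`. -/
structure IsStablePotential (W : ℝ → ℝ → ℝ) (V : ℝ → ℝ) (r q I J a c : ℝ) : Prop where
  continuous_pair : Continuous (Function.uncurry W)
  symm : ∀ s t, W s t = W t s
  r_pos : 0 < r
  I_pos : 0 < I
  J_pos : 0 < J
  a_pos : 0 < a
  c_pos : 0 < c
  lt : r < q
  abs_pair_le : ∀ s t, |W s t| ≤ (I + J * (|s| ^ r + |t| ^ r)) / 2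
  continuous_self : Continuous V
  le_self : ∀ s, a * |s| ^ q - c ≤ V s

section Energy

variable {X : Type*} (G : SimpleGraph X) [G.LocallyFinite] (W : ℝ → ℝ → ℝ) (V : ℝ → ℝ)

open Classical in
/-- The energy of `ω` in `Λ`: the local Hamiltonian in terms of the full configuration. -/
noncomputable def energy (Λ : Finset X) (ω : X → ℝ) : ℝ :=
  (1 / 2 : ℝ) * (∑ x ∈ Λ, ∑ y ∈ (G.neighborFinset x).filter (fun y => y ∈ Λ), W (ω x) (ω y))
    + (∑ x ∈ Λ, ∑ y ∈ (G.neighborFinset x).filter (fun y => y ∉ Λ), W (ω x) (ω y))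
    + ∑ x ∈ Λ, V (ω x)

open Classical in
lemma localHamiltonian_eq_energy (Λ : Finset X) (u : Λ → ℝ) (ξ : X → ℝ) :
    localHamiltonian G W V Λ u ξ = energy G W V Λ (glue Λ u ξ) := by
  unfold localHamiltonian energy
  congr 2
  refine Finset.sum_congr rfl fun x _ => Finset.sum_congr rfl fun y hy => ?_
  rw [glue_of_notMem u ξ (Finset.mem_filter.1 hy).2]

variable {G W V}

open Classical in
/-- The pair energy as a sum over ordered pairs in a large finite set. -/
lemma energy_eq_sum_pairs (hW : ∀ s t, W s t = W t s) {Λ B : Finset X} (hΛ : Λ ⊆ B)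
    (hB : ∀ x ∈ Λ, G.neighborFinset x ⊆ B) (ω : X → ℝ) :
    energy G W V Λ ω = (1 / 2 : ℝ) * (∑ x ∈ B, ∑ y ∈ B,
      if G.Adj x y ∧ (x ∈ Λ ∨ y ∈ Λ) then W (ω x) (ω y) else 0) + ∑ x ∈ Λ, V (ω x) := by
  have key : ∀ (P : X → Prop) [DecidablePred P],
      ∑ x ∈ Λ, ∑ y ∈ (G.neighborFinset x).filter P, W (ω x) (ω y) =
      ∑ x ∈ B, ∑ y ∈ B, if G.Adj x y ∧ x ∈ Λ ∧ P y then W (ω x) (ω y) else 0 := by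
    intro P _
    rw [← Finset.sum_subset hΛ]
    · refine Finset.sum_congr rfl fun x hx => ?_
      rw [← Finset.sum_filter]
      refine Finset.sum_congr ?_ fun _ _ => rfl
      ext y
      simp only [Finset.mem_filter, SimpleGraph.mem_neighborFinset, hx, true_and]
      exact ⟨fun h => ⟨hB x hx (by simpa using h.1), h⟩, fun h => h.2⟩
    · intro x _ hx
      simp [hx]
  -- By symmetry of `W` each boundary edge occurs in both orders with equal value, so the prefactor
  -- `1 / 2` counts it once.
  have hswap : (∑ x ∈ B, ∑ y ∈ B, if G.Adj x y ∧ x ∈ Λ ∧ y ∉ Λ then W (ω x) (ω y) else 0) =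
      ∑ x ∈ B, ∑ y ∈ B, if G.Adj x y ∧ x ∉ Λ ∧ y ∈ Λ then W (ω x) (ω y) else 0 := by
    rw [Finset.sum_comm]
    refine Finset.sum_congr rfl fun x _ => Finset.sum_congr rfl fun y _ => ?_
    rw [hW, G.adj_comm]
    congr 1
    simp only [eq_iff_iff]
    tauto
  have hsplit : (∑ x ∈ B, ∑ y ∈ B, if G.Adj x y ∧ (x ∈ Λ ∨ y ∈ Λ) then W (ω x) (ω y) else 0) =
      (∑ x ∈ B, ∑ y ∈ B, if G.Adj x y ∧ x ∈ Λ ∧ y ∈ Λ then W (ω x) (ω y) else 0) +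
      (∑ x ∈ B, ∑ y ∈ B, if G.Adj x y ∧ x ∈ Λ ∧ y ∉ Λ then W (ω x) (ω y) else 0) +
      ∑ x ∈ B, ∑ y ∈ B, if G.Adj x y ∧ x ∉ Λ ∧ y ∈ Λ then W (ω x) (ω y) else 0 := by
    simp only [← Finset.sum_add_distrib]
    refine Finset.sum_congr rfl fun x _ => Finset.sum_congr rfl fun y _ => ?_
    by_cases h1 : G.Adj x y <;> by_cases h2 : x ∈ Λ <;> by_cases h3 : y ∈ Λ <;> simp [h1, h2, h3]
  rw [energy, key, key, hsplit, ← hswap]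
  ring

/-- In `H_Δ - H_Λ` every term that touches `Λ` cancels: only edges with both endpoints off `Λ` and
vertices of `Δ \ Λ` remain. This is the source of consistency. -/
lemma energy_sub_energy_congr (hW : ∀ s t, W s t = W t s) {Λ Δ : Finset X} (h : Λ ⊆ Δ)
    {ω η : X → ℝ} (hωη : ∀ x ∉ Λ, ω x = η x) :
    energy G W V Δ ω - energy G W V Λ ω = energy G W V Δ η - energy G W V Λ η := by
  classical
  set B : Finset X := Δ ∪ Δ.biUnion fun x => G.neighborFinset x
  have hΔ : Δ ⊆ B := Finset.subset_union_left
  have hB : ∀ x ∈ Δ, G.neighborFinset x ⊆ B := fun x hx =>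
    (Finset.subset_biUnion_of_mem (fun x => G.neighborFinset x) hx).trans
      Finset.subset_union_right
  have hpair : ∀ ζ : X → ℝ, energy G W V Δ ζ - energy G W V Λ ζ =
      (1 / 2 : ℝ) * (∑ x ∈ B, ∑ y ∈ B, if G.Adj x y ∧ (x ∈ Δ ∨ y ∈ Δ) ∧ x ∉ Λ ∧ y ∉ Λ
        then W (ζ x) (ζ y) else 0) + ∑ x ∈ Δ \ Λ, V (ζ x) := by
    intro ζ
    rw [energy_eq_sum_pairs hW hΔ hB, energy_eq_sum_pairs hW (h.trans hΔ) fun x hx => hB x (h hx),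
      ← Finset.sum_sdiff h]
    have : (∑ x ∈ B, ∑ y ∈ B, if G.Adj x y ∧ (x ∈ Δ ∨ y ∈ Δ) then W (ζ x) (ζ y) else 0) =
        (∑ x ∈ B, ∑ y ∈ B, if G.Adj x y ∧ (x ∈ Δ ∨ y ∈ Δ) ∧ x ∉ Λ ∧ y ∉ Λ
          then W (ζ x) (ζ y) else 0) +
        ∑ x ∈ B, ∑ y ∈ B, if G.Adj x y ∧ (x ∈ Λ ∨ y ∈ Λ) then W (ζ x) (ζ y) else 0 := by
      simp only [← Finset.sum_add_distrib]
      refine Finset.sum_congr rfl fun x _ => Finset.sum_congr rfl fun y _ => ?_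
      have hx := @h x
      have hy := @h y
      by_cases h1 : G.Adj x y <;> by_cases h2 : x ∈ Λ <;> by_cases h3 : y ∈ Λ <;>
        simp_all
    rw [this]
    ring
  rw [hpair, hpair]
  congr 1
  · congr 1
    refine Finset.sum_congr rfl fun x _ => Finset.sum_congr rfl fun y _ => ?_
    split_ifs with hxy
    · rw [hωη x hxy.2.2.1, hωη y hxy.2.2.2]
    · rfl
  · exact Finset.sum_congr rfl fun x hx => by rw [hωη x (Finset.mem_sdiff.1 hx).2]

variable {r q I J a c : ℝ}

lemma IsStablePotential.continuous_energy (h : IsStablePotential W V r q I J a c)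
    (Λ : Finset X) : Continuous (energy G W V Λ) := by
  have hW : ∀ x y : X, Continuous fun ω : X → ℝ => W (ω x) (ω y) := fun x y =>
    h.continuous_pair.comp (by fun_prop : Continuous fun ω : X → ℝ => (ω x, ω y))
  have hV : ∀ x : X, Continuous fun ω : X → ℝ => V (ω x) := fun x =>
    h.continuous_self.comp (continuous_apply x)
  exact ((continuous_const.mul (continuous_finsetSum _ fun x _ =>
    continuous_finsetSum _ fun y _ => hW x y)).add (continuous_finsetSum _ fun x _ =>
    continuous_finsetSum _ fun y _ => hW x y)).add (continuous_finsetSum _ fun x _ => hV x)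

/-- Edges inside `Λ` are charged in full from both endpoints, although they enter the energy once;
the surplus is harmless because the bound on `|W|` is non-negative. -/
lemma IsStablePotential.le_energy (h : IsStablePotential W V r q I J a c) (Λ : Finset X)
    (ω : X → ℝ) :
    ∑ x ∈ Λ, (a * |ω x| ^ q - c) -
      ∑ x ∈ Λ, ∑ y ∈ G.neighborFinset x, (I + J * (|ω x| ^ r + |ω y| ^ r)) / 2 ≤
    energy G W V Λ ω := by
  classical
  have hI := h.I_pos
  have hJ := h.J_pos
  have hneg : ∀ x y, -((I + J * (|ω x| ^ r + |ω y| ^ r)) / 2) ≤ W (ω x) (ω y) := fun x y =>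
    (abs_le.1 (h.abs_pair_le _ _)).1
  have h1 : ∀ x ∈ Λ, -∑ y ∈ G.neighborFinset x, (I + J * (|ω x| ^ r + |ω y| ^ r)) / 2 ≤
      1 / 2 * ∑ y ∈ (G.neighborFinset x).filter (fun y => y ∈ Λ), W (ω x) (ω y) +
      ∑ y ∈ (G.neighborFinset x).filter (fun y => y ∉ Λ), W (ω x) (ω y) := by
    intro x _
    rw [← Finset.sum_filter_add_sum_filter_not (G.neighborFinset x) (fun y => y ∈ Λ), neg_add,
      ← Finset.sum_neg_distrib, ← Finset.sum_neg_distrib, Finset.mul_sum]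
    refine add_le_add (Finset.sum_le_sum fun y _ => ?_) (Finset.sum_le_sum fun y _ => hneg x y)
    have h2 := hneg x y
    have h3 : 0 ≤ (I + J * (|ω x| ^ r + |ω y| ^ r)) / 2 := by positivity
    linarith
  have h2 := Finset.sum_le_sum h1
  rw [Finset.sum_add_distrib, ← Finset.mul_sum, Finset.sum_neg_distrib] at h2
  have h3 : ∑ x ∈ Λ, (a * |ω x| ^ q - c) ≤ ∑ x ∈ Λ, V (ω x) :=
    Finset.sum_le_sum fun x _ => h.le_self _
  unfold energy
  linarith

/-- Lower bound of the energy that separates the variables inside and outside `Λ`. -/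
lemma IsStablePotential.exists_le_energy_glue (h : IsStablePotential W V r q I J a c)
    (Λ : Finset X) : ∃ (B : ℝ) (A : (X → ℝ) → ℝ), 0 ≤ B ∧ Continuous A ∧ ∀ u ξ,
      ∑ z : Λ, (a * |u z| ^ q - B * |u z| ^ r) - A ξ ≤ energy G W V Λ (glue Λ u ξ) := by
  have hr := h.r_pos
  have hI := h.I_pos
  have hJ := h.J_pos
  refine ⟨∑ x ∈ Λ, ∑ y ∈ G.neighborFinset x, J,
    fun ξ => ∑ x ∈ Λ, c + ∑ x ∈ Λ, ∑ y ∈ G.neighborFinset x, (I + J * |ξ y| ^ r) / 2,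
    Finset.sum_nonneg fun _ _ => Finset.sum_nonneg fun _ _ => hJ.le, ?_, fun u ξ => ?_⟩
  · have : ∀ y : X, Continuous fun ξ : X → ℝ => |ξ y| ^ r := fun y =>
      (continuous_abs.comp (continuous_apply y)).rpow_const fun _ => Or.inr hr.le
    fun_prop
  · refine le_trans ?_ (h.le_energy Λ (glue Λ u ξ))
    -- Every interior `|ω(y)|^r` is replaced by the whole sum `S`. The resulting constant depends on
    -- `Λ`, which does no harm because `r < q`.
    set S : ℝ := ∑ z : Λ, |u z| ^ r
    have hS : ∀ x, |glue Λ u ξ x| ^ r ≤ |ξ x| ^ r + S := by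
      intro x
      by_cases hx : x ∈ Λ
      · rw [glue_of_mem _ _ hx]
        have : |u ⟨x, hx⟩| ^ r ≤ S := Finset.single_le_sum (f := fun z : Λ => |u z| ^ r)
          (fun _ _ => by positivity) (Finset.mem_univ _)
        have : 0 ≤ |ξ x| ^ r := by positivity
        linarith
      · rw [glue_of_notMem _ _ hx]
        have : 0 ≤ S := Finset.sum_nonneg fun _ _ => by positivity
        linarith
    have hS' : ∀ x ∈ Λ, |glue Λ u ξ x| ^ r ≤ S := by
      intro x hx
      rw [glue_of_mem _ _ hx]
      exact Finset.single_le_sum (f := fun z : Λ => |u z| ^ r)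
          (fun _ _ => by positivity) (Finset.mem_univ _)
    have h1 : ∑ x ∈ Λ, ∑ y ∈ G.neighborFinset x,
          (I + J * (|glue Λ u ξ x| ^ r + |glue Λ u ξ y| ^ r)) / 2 ≤
        ∑ x ∈ Λ, ∑ y ∈ G.neighborFinset x, ((I + J * |ξ y| ^ r) / 2 + J * S) := by
      refine Finset.sum_le_sum fun x hx => Finset.sum_le_sum fun y _ => ?_
      have := mul_le_mul_of_nonneg_left (add_le_add (hS' x hx) (hS y)) hJ.le
      linarith
    have h2 : ∑ x ∈ Λ, (a * |glue Λ u ξ x| ^ q - c) =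
        ∑ z : Λ, a * |u z| ^ q - ∑ x ∈ Λ, c := by
      rw [Finset.sum_sub_distrib, ← Finset.sum_coe_sort Λ fun x => a * |glue Λ u ξ x| ^ q]
      simp [glue_of_mem]
    simp only [Finset.sum_add_distrib, ← Finset.sum_mul] at h1
    rw [h2, Finset.sum_sub_distrib, ← Finset.mul_sum _ _ (∑ x ∈ Λ, ∑ y ∈ G.neighborFinset x, J)]
    linarith

end Energy

/-! ### The local specification -/

section Specification

variable {X : Type*} {G : SimpleGraph X} [G.LocallyFinite] {W : ℝ → ℝ → ℝ} {V : ℝ → ℝ}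
  {r q I J a c : ℝ}

variable (G W V) in
/-- The Boltzmann factor `exp (-H_Λ)` as a function of the full configuration. -/
noncomputable def boltzmann (Λ : Finset X) (ω : X → ℝ) : ℝ≥0∞ :=
  ENNReal.ofReal (Real.exp (-energy G W V Λ ω))

lemma IsStablePotential.measurable_boltzmann [Countable X]
    (h : IsStablePotential W V r q I J a c) (Λ : Finset X) : Measurable (boltzmann G W V Λ) :=
  ENNReal.measurable_ofReal.comp
    (Real.continuous_exp.comp (h.continuous_energy Λ).neg).measurable

lemma partitionFunction_eq (Λ : Finset X) (ξ : X → ℝ) :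
    partitionFunction G W V Λ ξ = marg Λ (boltzmann G W V Λ) ξ := by
  simp only [partitionFunction, marg, boltzmann, localHamiltonian_eq_energy]

/-- Integrals against the local specification. -/
lemma IsStablePotential.lintegral_gibbsSpec [Countable X]
    (h : IsStablePotential W V r q I J a c) (Λ : Finset X) (ξ : X → ℝ) {f : (X → ℝ) → ℝ≥0∞}
    (hf : Measurable f) :
    ∫⁻ ω, f ω ∂gibbsSpec G W V Λ ξ =
      (marg Λ (boltzmann G W V Λ) ξ)⁻¹ * marg Λ (fun ω => f ω * boltzmann G W V Λ ω) ξ := by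
  have hb : Measurable fun u : Λ → ℝ => boltzmann G W V Λ (glue Λ u ξ) :=
    (h.measurable_boltzmann Λ).comp (measurable_glue_left Λ ξ)
  have hd : (fun u => ENNReal.ofReal (Real.exp (-localHamiltonian G W V Λ u ξ))) =
      fun u : Λ → ℝ => boltzmann G W V Λ (glue Λ u ξ) := by
    simp only [boltzmann, localHamiltonian_eq_energy]
  rw [gibbsSpec, lintegral_smul_measure, lintegral_map hf (measurable_glue_left Λ ξ), hd,
    lintegral_withDensity_eq_lintegral_mul _ hb
      (g := fun u => f (glue Λ u ξ)) (hf.comp (measurable_glue_left Λ ξ)),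
    partitionFunction_eq, smul_eq_mul]
  simp only [marg, Pi.mul_apply, mul_comm]

/-- Pointwise domination of the Boltzmann factor, locally uniform in the boundary condition and
robust under a perturbation of lower order. -/
lemma IsStablePotential.exists_integrable_bound (h : IsStablePotential W V r q I J a c)
    (Λ : Finset X) {p : ℝ} (hrp : r < p) (hpq : p < q) :
    ∃ (A : (X → ℝ) → ℝ) (g : (Λ → ℝ) → ℝ), Continuous A ∧ Integrable g ∧ (∀ u, 0 ≤ g u) ∧
      ∀ u ξ, Real.exp (∑ z : Λ, |u z| ^ p) * Real.exp (-energy G W V Λ (glue Λ u ξ)) ≤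
        Real.exp (A ξ) * g u := by
  obtain ⟨B, A, hB, hA, hle⟩ := h.exists_le_energy_glue (G := G) Λ
  obtain ⟨C, hC, hCle⟩ := exists_rpow_le_mul_rpow_add h.r_pos hrp one_pos
  -- In `B + 1`, the `B` comes from raising the exponent `r` to `p` and the `1` pays for the factor
  -- `exp (∑ |u z| ^ p)`.
  refine ⟨fun ξ => A ξ + ∑ z : Λ, B * C, fun u => ∏ z : Λ,
    Real.exp ((B + 1) * |u z| ^ p - a * |u z| ^ q), by fun_prop, ?_, fun u => by positivity,
    fun u ξ => ?_⟩
  · exact Integrable.fintype_prod (f := fun (_ : Λ) t =>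
      Real.exp ((B + 1) * |t| ^ p - a * |t| ^ q))
      fun _ => integrable_exp_rpow_sub_rpow (h.r_pos.trans hrp) hpq h.a_pos (by positivity)
  · simp only [← Real.exp_sum, ← Real.exp_add]
    refine Real.exp_le_exp.2 ?_
    have h1 : ∑ z : Λ, B * |u z| ^ r ≤ ∑ z : Λ, (B * |u z| ^ p + B * C) :=
      Finset.sum_le_sum fun z _ => by
        have := mul_le_mul_of_nonneg_left (hCle |u z| (abs_nonneg _)) hB
        linarith
    have h2 := hle u ξ
    simp only [Finset.sum_sub_distrib, Finset.sum_add_distrib, add_mul, one_mul] at h1 h2 ⊢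
    linarith

/-- This yields both the finiteness of `Z_Λ(ξ)` and the a priori finite moments without which the
recursion below could not be absorbed. -/
lemma IsStablePotential.marg_exp_mul_boltzmann_lt_top (h : IsStablePotential W V r q I J a c)
    (Λ : Finset X) {p : ℝ} (hrp : r < p) (hpq : p < q) (ξ : X → ℝ) :
    marg Λ (fun ω => ENNReal.ofReal (Real.exp (∑ z ∈ Λ, |ω z| ^ p)) * boltzmann G W V Λ ω) ξ
      < ∞ := by
  obtain ⟨A, g, -, hg, -, hle⟩ := h.exists_integrable_bound (G := G) Λ hrp hpq
  refine lt_of_le_of_lt (lintegral_mono fun u => ?_)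
    ((hg.const_mul (Real.exp (A ξ))).lintegral_lt_top)
  simp only [boltzmann, ← ENNReal.ofReal_mul (Real.exp_pos _).le]
  refine ENNReal.ofReal_le_ofReal (le_trans (le_of_eq ?_) (hle u ξ))
  rw [← Finset.sum_coe_sort Λ fun x => |glue Λ u ξ x| ^ p]
  simp [glue_of_mem]

lemma IsStablePotential.marg_boltzmann_ne_top (h : IsStablePotential W V r q I J a c)
    (Λ : Finset X) (ξ : X → ℝ) : marg Λ (boltzmann G W V Λ) ξ ≠ ∞ := by
  obtain ⟨p, hrp, hpq⟩ := exists_between h.lt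
  refine ne_top_of_le_ne_top (h.marg_exp_mul_boltzmann_lt_top (G := G) Λ hrp hpq ξ).ne
    (lintegral_mono fun u => le_mul_of_one_le_left' ?_)
  rw [ENNReal.one_le_ofReal]
  exact Real.one_le_exp (Finset.sum_nonneg fun _ _ => by positivity)

lemma IsStablePotential.marg_boltzmann_ne_zero [Countable X]
    (h : IsStablePotential W V r q I J a c)
    (Λ : Finset X) (ξ : X → ℝ) : marg Λ (boltzmann G W V Λ) ξ ≠ 0 := by
  intro h0
  replace h0 := (lintegral_eq_zero_iff
    ((h.measurable_boltzmann Λ).comp (measurable_glue_left Λ ξ))).1 h0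
  have h1 : ∀ u : Λ → ℝ, boltzmann G W V Λ (glue Λ u ξ) ≠ 0 := fun u => by
    simp [boltzmann, Real.exp_pos]
  obtain ⟨u, hu⟩ := h0.exists
  exact h1 u hu

lemma IsStablePotential.isProbabilityMeasure_gibbsSpec [Countable X]
    (h : IsStablePotential W V r q I J a c) (Λ : Finset X) (ξ : X → ℝ) :
    IsProbabilityMeasure (gibbsSpec G W V Λ ξ) := by
  refine ⟨?_⟩
  have := h.lintegral_gibbsSpec (G := G) Λ ξ (f := fun _ => 1) measurable_const
  simp only [lintegral_one, one_mul] at this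
  rw [this]
  exact ENNReal.inv_mul_cancel (h.marg_boltzmann_ne_zero Λ ξ) (h.marg_boltzmann_ne_top Λ ξ)

lemma IsStablePotential.measurable_lintegral_gibbsSpec [Countable X]
    (h : IsStablePotential W V r q I J a c) (Λ : Finset X) {f : (X → ℝ) → ℝ≥0∞}
    (hf : Measurable f) : Measurable fun ξ => ∫⁻ ω, f ω ∂gibbsSpec G W V Λ ξ := by
  simp only [h.lintegral_gibbsSpec Λ _ hf]
  exact (measurable_marg Λ (h.measurable_boltzmann Λ)).inv.mul
    (measurable_marg Λ (hf.mul (h.measurable_boltzmann Λ)))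

lemma IsStablePotential.measurable_gibbsSpec [Countable X]
    (h : IsStablePotential W V r q I J a c) (Λ : Finset X) :
    Measurable (gibbsSpec G W V Λ) := by
  refine Measure.measurable_of_measurable_coe _ fun A hA => ?_
  have := h.measurable_lintegral_gibbsSpec (G := G) Λ
    (measurable_const.indicator hA : Measurable (A.indicator fun _ => (1 : ℝ≥0∞)))
  simpa only [lintegral_indicator_const hA, one_mul] using this

/-- Functions of the boundary condition factor out of integrals against the specification. -/
lemma IsStablePotential.lintegral_gibbsSpec_of_congr [Countable X]
    (h : IsStablePotential W V r q I J a c) (Λ : Finset X) {f : (X → ℝ) → ℝ≥0∞}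
    (hf : Measurable f) (hc : ∀ u ξ, f (glue Λ u ξ) = f ξ) (ξ : X → ℝ) :
    ∫⁻ ω, f ω ∂gibbsSpec G W V Λ ξ = f ξ := by
  rw [h.lintegral_gibbsSpec Λ ξ hf, marg_mul_left (h.measurable_boltzmann Λ) hc, mul_comm (f ξ),
    ← mul_assoc, ENNReal.inv_mul_cancel (h.marg_boltzmann_ne_zero Λ ξ)
    (h.marg_boltzmann_ne_top Λ ξ), one_mul]

/-- Consistency of the specification. -/
lemma IsStablePotential.lintegral_lintegral_gibbsSpec [Countable X]
    (h : IsStablePotential W V r q I J a c) {Λ Δ : Finset X} (hΛ : Λ ⊆ Δ) (ξ : X → ℝ)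
    {f : (X → ℝ) → ℝ≥0∞} (hf : Measurable f) :
    ∫⁻ η, ∫⁻ ω, f ω ∂gibbsSpec G W V Λ η ∂gibbsSpec G W V Δ ξ =
      ∫⁻ ω, f ω ∂gibbsSpec G W V Δ ξ := by
  classical
  rw [h.lintegral_gibbsSpec Δ ξ (h.measurable_lintegral_gibbsSpec Λ hf),
    h.lintegral_gibbsSpec Δ ξ hf]
  congr 1
  set ρ := boltzmann G W V Λ with hρ
  -- The factorization `exp (-H_Δ) = g * exp (-H_Λ)` has `g` independent of the coordinates in `Λ`.
  -- Integrating these first pulls `g` out, and the normalization of `π_Λ` cancels.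
  set g : (X → ℝ) → ℝ≥0∞ := fun ω =>
    ENNReal.ofReal (Real.exp (-(energy G W V Δ ω - energy G W V Λ ω))) with hg
  have hρm : Measurable ρ := h.measurable_boltzmann Λ
  have hgc : ∀ u ξ, g (glue Λ u ξ) = g ξ := fun u ξ => by
    simp only [hg]
    rw [energy_sub_energy_congr h.symm hΛ fun x hx => glue_of_notMem u ξ hx]
  have hmul : ∀ ω, boltzmann G W V Δ ω = g ω * ρ ω := fun ω => by
    simp only [hg, hρ, boltzmann]
    rw [← ENNReal.ofReal_mul (Real.exp_pos _).le, ← Real.exp_add]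
    congr 2
    ring
  have hu : Δ = (Δ \ Λ) ∪ Λ := by rw [Finset.sdiff_union_of_subset hΛ]
  have hpm := h.measurable_lintegral_gibbsSpec (G := G) Λ hf
  have key : marg Λ (fun ω => (∫⁻ η, f η ∂gibbsSpec G W V Λ ω) * boltzmann G W V Δ ω) =
      marg Λ (fun ω => f ω * boltzmann G W V Δ ω) := by
    ext η
    have e1 : (fun ω => (∫⁻ η, f η ∂gibbsSpec G W V Λ ω) * boltzmann G W V Δ ω) =
        fun ω => ((∫⁻ η, f η ∂gibbsSpec G W V Λ ω) * g ω) * ρ ω := by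
      ext ω; rw [hmul, mul_assoc]
    have e2 : (fun ω => f ω * boltzmann G W V Δ ω) = fun ω => g ω * (f ω * ρ ω) := by
      ext ω; rw [hmul]; ring
    rw [e1, e2, marg_mul_left (f := fun ω => f ω * ρ ω) (g := g) (hf.mul hρm) hgc,
      marg_mul_left (g := fun ω => (∫⁻ η, f η ∂gibbsSpec G W V Λ ω) * g ω) hρm
        (fun u ξ => by
          simp only [hgc, h.lintegral_gibbsSpec _ _ hf, marg_glue]),
      h.lintegral_gibbsSpec Λ η hf]
    rw [mul_comm (_ * _) (g η), mul_assoc, mul_comm (_ * _) (marg Λ ρ η), ← mul_assoc (marg Λ ρ η),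
      ENNReal.mul_inv_cancel (h.marg_boltzmann_ne_zero Λ η) (h.marg_boltzmann_ne_top Λ η), one_mul]
  rw [hu, marg_union Finset.sdiff_disjoint (by
      rw [← hu]; exact hpm.mul (h.measurable_boltzmann Δ)),
    marg_union Finset.sdiff_disjoint (by
      rw [← hu]; exact hf.mul (h.measurable_boltzmann Δ)), ← hu, key]

/-- The Feller property of the unnormalized specification. -/
lemma IsStablePotential.continuous_marg [Countable X] (h : IsStablePotential W V r q I J a c)
    (Λ : Finset X) {f : (X → ℝ) → ℝ} (hf : Continuous f) {K : ℝ} (h0 : ∀ ω, 0 ≤ f ω)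
    (hK : ∀ ω, f ω ≤ K) :
    Continuous (marg Λ fun ω => ENNReal.ofReal (f ω) * boltzmann G W V Λ ω) := by
  obtain ⟨p, hrp, hpq⟩ := exists_between h.lt
  obtain ⟨A, g, hA, hg, hg0, hle⟩ := h.exists_integrable_bound (G := G) Λ hrp hpq
  have hE := h.continuous_energy (G := G) Λ
  have hF : Continuous fun z : (Λ → ℝ) × (X → ℝ) =>
      f (glue Λ z.1 z.2) * Real.exp (-energy G W V Λ (glue Λ z.1 z.2)) := by fun_prop
  have hle' : ∀ u ξ, ‖f (glue Λ u ξ) * Real.exp (-energy G W V Λ (glue Λ u ξ))‖ ≤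
      K * (Real.exp (A ξ) * g u) := by
    intro u ξ
    rw [Real.norm_eq_abs, abs_of_nonneg (mul_nonneg (h0 _) (Real.exp_pos _).le)]
    refine mul_le_mul (hK _) (le_trans ?_ (hle u ξ)) (Real.exp_pos _).le ((h0 0).trans (hK 0))
    exact le_mul_of_one_le_left (Real.exp_pos _).le
      (Real.one_le_exp (Finset.sum_nonneg fun _ _ => by positivity))
  have hmeas : ∀ ξ, AEStronglyMeasurable
      (fun u => f (glue Λ u ξ) * Real.exp (-energy G W V Λ (glue Λ u ξ))) volume := fun ξ =>
    (hF.comp (by fun_prop : Continuous fun u : Λ → ℝ => (u, ξ))).aestronglyMeasurable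
  have hint : Continuous fun ξ =>
      ∫ u, f (glue Λ u ξ) * Real.exp (-energy G W V Λ (glue Λ u ξ)) := by
    refine continuous_iff_continuousAt.2 fun ξ₀ => ?_
    -- Continuity of `A` makes one dominating function valid for all boundary conditions near `ξ₀`.
    have hev : ∀ᶠ ξ in 𝓝 ξ₀, A ξ < A ξ₀ + 1 :=
      hA.continuousAt.eventually_lt_const (by linarith)
    refine continuousAt_of_dominated (bound := fun u => K * (Real.exp (A ξ₀ + 1) * g u))
      (Eventually.of_forall hmeas) ?_ ((hg.const_mul _).const_mul _)
      (ae_of_all _ fun u => (hF.comp (by fun_prop : Continuous fun ξ : X → ℝ =>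
        (u, ξ))).continuousAt)
    filter_upwards [hev] with ξ hξ
    refine ae_of_all _ fun u => (hle' u ξ).trans ?_
    have := (h0 0).trans (hK 0)
    have := hg0 u
    gcongr
  convert ENNReal.continuous_ofReal.comp hint using 1
  ext ξ
  rw [Function.comp_apply, ofReal_integral_eq_lintegral_ofReal
    (((hg.const_mul _).const_mul K).mono' (hmeas ξ) (ae_of_all _ fun u => hle' u ξ))
    (ae_of_all _ fun u => mul_nonneg (h0 _) (Real.exp_pos _).le)]
  simp only [marg, boltzmann, ENNReal.ofReal_mul (h0 _)]

/-- The Feller property of the specification. -/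
lemma IsStablePotential.continuous_lintegral_gibbsSpec [Countable X]
    (h : IsStablePotential W V r q I J a c)
    (Λ : Finset X) {f : (X → ℝ) → ℝ} (hf : Continuous f) {K : ℝ} (h0 : ∀ ω, 0 ≤ f ω)
    (hK : ∀ ω, f ω ≤ K) :
    Continuous fun ξ => ∫⁻ ω, ENNReal.ofReal (f ω) ∂gibbsSpec G W V Λ ξ := by
  have hm : Measurable fun ω => ENNReal.ofReal (f ω) :=
    ENNReal.measurable_ofReal.comp hf.measurable
  simp only [h.lintegral_gibbsSpec Λ _ hm]
  have h1 := h.continuous_marg (G := G) Λ (f := fun _ => 1) continuous_const (K := 1)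
    (fun _ => zero_le_one) fun _ => le_rfl
  simp only [ENNReal.ofReal_one, one_mul] at h1
  refine continuous_iff_continuousAt.2 fun ξ => ?_
  exact ENNReal.Tendsto.mul (h1.inv.tendsto ξ)
    (Or.inl (ENNReal.inv_ne_zero.2 (h.marg_boltzmann_ne_top Λ ξ)))
    ((h.continuous_marg Λ hf h0 hK).tendsto ξ)
    (Or.inr (ENNReal.inv_ne_top.2 (h.marg_boltzmann_ne_zero Λ ξ)))

/-- The set of the probability measures that satisfy the DLR equation in `Λ` is closed. -/
lemma IsStablePotential.isClosed_setOf_bind_eq [Countable X]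
    (h : IsStablePotential W V r q I J a c) (Λ : Finset X) :
    IsClosed {μ : ProbabilityMeasure (X → ℝ) |
      (μ : Measure (X → ℝ)).bind (gibbsSpec G W V Λ) = μ} := by
  have hP := h.isProbabilityMeasure_gibbsSpec (G := G) Λ
  have hset : {μ : ProbabilityMeasure (X → ℝ) |
      (μ : Measure (X → ℝ)).bind (gibbsSpec G W V Λ) = μ} =
      ⋂ f : BoundedContinuousFunction (X → ℝ) NNReal, {μ : ProbabilityMeasure (X → ℝ) | ∫⁻ ξ, ∫⁻ ω, f ω
        ∂gibbsSpec G W V Λ ξ ∂(μ : Measure (X → ℝ)) = ∫⁻ ω, f ω ∂(μ : Measure (X → ℝ))} := by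
    ext μ
    simp only [Set.mem_iInter, Set.mem_ofPred_eq]
    have hb : ∀ f : BoundedContinuousFunction (X → ℝ) NNReal,
        ∫⁻ ω, f ω ∂(μ : Measure (X → ℝ)).bind (gibbsSpec G W V Λ) =
        ∫⁻ ξ, ∫⁻ ω, f ω ∂gibbsSpec G W V Λ ξ ∂(μ : Measure (X → ℝ)) := fun f =>
      Measure.lintegral_bind (h.measurable_gibbsSpec Λ).aemeasurable
        (measurable_coe_nnreal_ennreal.comp f.continuous.measurable).aemeasurable
    constructor
    · intro hμ f
      rw [← hb, hμ]
    · intro hμ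
      have : IsProbabilityMeasure ((μ : Measure (X → ℝ)).bind (gibbsSpec G W V Λ)) :=
        isProbabilityMeasure_bind (h.measurable_gibbsSpec Λ).aemeasurable
          (ae_of_all _ hP)
      exact ext_of_forall_lintegral_eq_of_IsFiniteMeasure fun f => by rw [hb, hμ]
  rw [hset]
  refine isClosed_iInter fun f => ?_
  obtain ⟨K, hK⟩ : ∃ K : NNReal, ∀ ω, f ω ≤ K := ⟨nndist f 0, fun ω => by
    simpa using f.nndist_coe_le_nndist (g := 0) ω⟩
  have hc : Continuous fun ξ => ∫⁻ ω, f ω ∂gibbsSpec G W V Λ ξ := by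
    have := h.continuous_lintegral_gibbsSpec (G := G) Λ (f := fun ω => (f ω : ℝ)) (K := K)
      (NNReal.continuous_coe.comp f.continuous) (fun _ => NNReal.coe_nonneg _)
      fun ω => NNReal.coe_le_coe.2 (hK ω)
    simpa only [ENNReal.ofReal_coe_nnreal] using this
  have hle : ∀ ξ, ∫⁻ ω, f ω ∂gibbsSpec G W V Λ ξ ≤ K := fun ξ => by
    refine (lintegral_mono (g := fun _ => (K : ℝ≥0∞)) fun ω =>
      ENNReal.coe_le_coe.2 (hK ω)).trans ?_
    simp
  have hne : ∀ ξ, ∫⁻ ω, f ω ∂gibbsSpec G W V Λ ξ ≠ ∞ := fun ξ =>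
    ne_top_of_le_ne_top ENNReal.coe_ne_top (hle ξ)
  -- By the Feller property `π_Λ f` is again bounded and continuous, so the equation tested on `f`
  -- equates two weakly continuous functionals of `μ`.
  let F : BoundedContinuousFunction (X → ℝ) NNReal := BoundedContinuousFunction.mkOfBound
    ⟨fun ξ => (∫⁻ ω, f ω ∂gibbsSpec G W V Λ ξ).toNNReal,
      ENNReal.continuousOn_toNNReal.comp_continuous hc hne⟩ K (fun ξ η => by
        rw [NNReal.dist_eq, abs_sub_le_iff]
        have h1 : ∀ ξ, ((∫⁻ ω, f ω ∂gibbsSpec G W V Λ ξ).toNNReal : ℝ) ≤ K := fun ξ =>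
          NNReal.coe_le_coe.2 (by simpa using ENNReal.toNNReal_mono ENNReal.coe_ne_top (hle ξ))
        have h2 : ∀ ξ, 0 ≤ ((∫⁻ ω, f ω ∂gibbsSpec G W V Λ ξ).toNNReal : ℝ) := fun ξ =>
          NNReal.coe_nonneg _
        exact ⟨(sub_le_self _ (h2 _)).trans (h1 _), (sub_le_self _ (h2 _)).trans (h1 _)⟩)
  have hF : ∀ ξ, (F ξ : ℝ≥0∞) = ∫⁻ ω, f ω ∂gibbsSpec G W V Λ ξ := fun ξ =>
    ENNReal.coe_toNNReal (hne ξ)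
  simp only [← hF]
  exact isClosed_eq (ProbabilityMeasure.continuous_lintegral_boundedContinuousFunction F)
    (ProbabilityMeasure.continuous_lintegral_boundedContinuousFunction f)

lemma IsStablePotential.isGibbs_iff [Countable X]
    (h : IsStablePotential W V r q I J a c) (μ : ProbabilityMeasure (X → ℝ)) :
    IsGibbs G W V μ ↔ ∀ Λ : Finset X, Λ.Nonempty →
      (μ : Measure (X → ℝ)).bind (gibbsSpec G W V Λ) = μ := by
  constructor
  · intro hμ Λ hΛ
    ext A hA
    rw [Measure.bind_apply hA (h.measurable_gibbsSpec Λ).aemeasurable, ← hμ A hA Λ hΛ]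
  · intro hμ A hA Λ hΛ
    rw [← Measure.bind_apply hA (h.measurable_gibbsSpec Λ).aemeasurable, hμ Λ hΛ]

lemma IsStablePotential.bind_gibbsSpec_bind [Countable X]
    (h : IsStablePotential W V r q I J a c) {Λ Δ : Finset X} (hΛ : Λ ⊆ Δ) (ξ : X → ℝ) :
    (gibbsSpec G W V Δ ξ).bind (gibbsSpec G W V Λ) = gibbsSpec G W V Δ ξ := by
  ext A hA
  rw [Measure.bind_apply hA (h.measurable_gibbsSpec Λ).aemeasurable]
  have := h.lintegral_lintegral_gibbsSpec (G := G) hΛ ξ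
    (measurable_const.indicator hA : Measurable (A.indicator fun _ => (1 : ℝ≥0∞)))
  simpa only [lintegral_indicator_const hA, one_mul] using this

/-- Consistency gives `μ π_Λ = μ π_Δ π_Λ = μ π_Δ = μ`. Hence the sets of solutions in `Λ` decrease
with `Λ`, as the compactness argument for existence needs. -/
lemma IsStablePotential.bind_eq_of_subset [Countable X]
    (h : IsStablePotential W V r q I J a c) {Λ Δ : Finset X} (hΛ : Λ ⊆ Δ)
    {μ : Measure (X → ℝ)} (hμ : μ.bind (gibbsSpec G W V Δ) = μ) :
    μ.bind (gibbsSpec G W V Λ) = μ := by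
  conv_lhs => rw [← hμ]
  rw [Measure.bind_bind (h.measurable_gibbsSpec Δ).aemeasurable
    (h.measurable_gibbsSpec Λ).aemeasurable]
  simp only [h.bind_gibbsSpec_bind hΛ, hμ]

end Specification

/-! ### Moment estimates -/

section Moments

variable {X : Type*} {G : SimpleGraph X} [G.LocallyFinite] {W : ℝ → ℝ → ℝ} {V : ℝ → ℝ}
  {r q I J a c : ℝ}

lemma energy_singleton_update [DecidableEq X] (x : X) (ξ : X → ℝ) (t : ℝ) :
    energy G W V {x} (Function.update ξ x t) = ∑ y ∈ G.neighborFinset x, W t (ξ y) + V t := by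
  classical
  have h1 : (G.neighborFinset x).filter (fun y => y ∈ ({x} : Finset X)) = ∅ := by
    ext y
    simp only [Finset.mem_filter, SimpleGraph.mem_neighborFinset, Finset.mem_singleton,
      Finset.notMem_empty, iff_false, not_and]
    exact fun h e => h.ne e.symm
  have h2 : (G.neighborFinset x).filter (fun y => y ∉ ({x} : Finset X)) = G.neighborFinset x := by
    ext y
    simp only [Finset.mem_filter, SimpleGraph.mem_neighborFinset, Finset.mem_singleton,
      and_iff_left_iff_imp]
    exact fun h e => h.ne e.symm
  have h3 : ∀ y ∈ G.neighborFinset x, Function.update ξ x t y = ξ y := fun y hy =>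
    Function.update_of_ne (by
      rw [SimpleGraph.mem_neighborFinset] at hy; exact hy.ne') _ _
  simp only [energy, Finset.sum_singleton, Function.update_self]
  have e1 : ∀ inst : DecidablePred fun y => y ∈ ({x} : Finset X),
      @Finset.filter X (fun y => y ∈ ({x} : Finset X)) inst (G.neighborFinset x) = ∅ :=
    fun inst => by convert h1
  have e2 : ∀ inst : DecidablePred fun y => y ∉ ({x} : Finset X),
      @Finset.filter X (fun y => y ∉ ({x} : Finset X)) inst (G.neighborFinset x) =
        G.neighborFinset x := fun inst => by convert h2
  rw [e1, e2, Finset.sum_empty, mul_zero, zero_add,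
    Finset.sum_congr rfl fun y hy => by rw [h3 y hy]]

lemma card_mul_rpow_le_degreeSum {θ : ℝ} (hθ : 0 < θ) (x : X) :
    (G.degree x : ℝ) * (G.degree x : ℝ) ^ θ ≤ degreeSum G θ x := by
  have : (G.degree x : ℝ) * (G.degree x : ℝ) ^ θ =
      ∑ y ∈ G.neighborFinset x, (G.degree x : ℝ) ^ θ := by
    rw [Finset.sum_const, nsmul_eq_mul, SimpleGraph.card_neighborFinset_eq_degree]
  rw [this]
  refine Finset.sum_le_sum fun y hy => ?_
  rw [SimpleGraph.mem_neighborFinset] at hy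
  have : (1 : ℝ) ≤ G.degree y := by
    exact_mod_cast (G.degree_pos_iff_exists_adj y).2 ⟨x, hy.symm⟩
  refine Real.rpow_le_rpow (by positivity) ?_ hθ.le
  exact le_mul_of_one_le_right (by positivity) this

lemma degree_le_degreeSum {θ : ℝ} (hθ : 0 < θ) (x : X) :
    (G.degree x : ℝ) ≤ degreeSum G θ x := by
  refine le_trans ?_ (card_mul_rpow_le_degreeSum hθ x)
  rcases Nat.eq_zero_or_pos (G.degree x) with h | h
  · simp [h]
  · have : (1 : ℝ) ≤ G.degree x := by exact_mod_cast h
    exact le_mul_of_one_le_right (by positivity) (Real.one_le_rpow this hθ.le)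

/-- The moment estimate for the one-point specification. -/
lemma IsStablePotential.exists_lintegral_gibbsSpec_singleton_le [Countable X]
    (h : IsStablePotential W V r q I J a c) {θ p δ : ℝ} (hθ : 0 < θ) (hp : r + r / θ ≤ p)
    (hpq : p < q) (hδ : 0 < δ) : ∃ C : ℝ, 0 ≤ C ∧ ∀ (x : X) (ξ : X → ℝ),
      ∫⁻ ω, ENNReal.ofReal (|ω x| ^ p) ∂gibbsSpec G W V {x} ξ ≤
        ENNReal.ofReal (C * (1 + degreeSum G θ x) +
          δ * ∑ y ∈ G.neighborFinset x, |ξ y| ^ p / ((G.degree x : ℝ) * G.degree y)) := by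
  classical
  have hr := h.r_pos
  have hI := h.I_pos
  have hJ := h.J_pos
  have ha := h.a_pos
  have hc := h.c_pos
  have hrθ : 0 < r / θ := by positivity
  have hrp : r < p := by linarith
  have hp0 : 0 < p := hr.trans hrp
  -- The only place where the size of `p₀ = r + r / θ` matters.
  have hexp : r / (p - r) ≤ θ := by
    rw [div_le_iff₀ (by linarith)]
    have := mul_le_mul_of_nonneg_left (by linarith : r / θ ≤ p - r) hθ.le
    rwa [mul_div_cancel₀ _ hθ.ne'] at this
  -- The two scales are tuned so that multiplication by `J / 2 * n`, respectively by `J`, leaves the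
  -- coefficients `1` and `δ`.
  obtain ⟨C₁, hC₁, hyoung₁⟩ := exists_rpow_le_rpow_div_add hr hrp (ε := 2 / J) (by positivity)
  obtain ⟨C₂, hC₂, hyoung₂⟩ := exists_rpow_le_rpow_div_add hr hrp (ε := δ / J) (by positivity)
  obtain ⟨v, hv⟩ := isCompact_Icc.exists_bound_of_continuousOn
    (s := Set.Icc (0 : ℝ) 1) h.continuous_self.continuousOn
  have hv0 : 0 ≤ v := (norm_nonneg _).trans (hv 0 (by simp))
  have hQi := integrable_exp_rpow_sub_rpow hp0 hpq ha zero_le_two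
  -- One `|t| ^ p` is the exponential moment; the other absorbs the part of the pair energy that
  -- depends on `t`.
  set Q : ℝ := ∫ t : ℝ, Real.exp (2 * |t| ^ p - a * |t| ^ q)
  have hQ0 : 0 ≤ Q := integral_nonneg fun t => (Real.exp_pos _).le
  refine ⟨(c + Q + v + 1) + (I + J / 2 + J / 2 * C₁ + J * C₂), by positivity, fun x ξ => ?_⟩
  set n : ℝ := (G.degree x : ℝ) with hn
  have hn0 : 0 ≤ n := Nat.cast_nonneg _
  set S : ℝ := ∑ y ∈ G.neighborFinset x, |ξ y| ^ r with hS
  have hS0 : 0 ≤ S := Finset.sum_nonneg fun _ _ => by positivity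
  set m := degreeSum G θ x with hm
  have hm1 : n ≤ m := degree_le_degreeSum hθ x
  have hm2 : n * n ^ θ ≤ m := card_mul_rpow_le_degreeSum hθ x
  set b : (X → ℝ) → ℝ≥0∞ := boltzmann G W V {x} with hb
  have hbm : Measurable b := h.measurable_boltzmann {x}
  have hpair : ∀ t, |∑ y ∈ G.neighborFinset x, W t (ξ y)| ≤ (n * I + J * (n * |t| ^ r + S)) / 2 := by
    intro t
    calc |∑ y ∈ G.neighborFinset x, W t (ξ y)|
        ≤ ∑ y ∈ G.neighborFinset x, (I + J * (|t| ^ r + |ξ y| ^ r)) / 2 :=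
          (Finset.abs_sum_le_sum_abs _ _).trans (Finset.sum_le_sum fun y _ => h.abs_pair_le _ _)
      _ = (n * I + J * (n * |t| ^ r + S)) / 2 := by
          rw [← Finset.sum_div, Finset.sum_add_distrib, ← Finset.mul_sum, Finset.sum_add_distrib]
          simp only [Finset.sum_const, SimpleGraph.card_neighborFinset_eq_degree, nsmul_eq_mul]
          rfl
  have hyoung : ∀ t : ℝ, J / 2 * (n * |t| ^ r) ≤ |t| ^ p + J / 2 * C₁ * (n * n ^ θ) := by
    intro t
    rcases Nat.eq_zero_or_pos (G.degree x) with h0 | h0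
    · have : n = 0 := by simp [hn, h0]
      rw [this]
      simp only [zero_mul, mul_zero, add_zero]
      positivity
    · have hn1 : 1 ≤ n := by rw [hn]; exact_mod_cast h0
      have h1 := hyoung₁ n hn1 |t| (abs_nonneg t)
      have h2 : n ^ (r / (p - r)) ≤ n ^ θ := Real.rpow_le_rpow_of_exponent_le hn1 hexp
      have h3 : |t| ^ r ≤ 2 / J * |t| ^ p / n + C₁ * n ^ θ :=
        h1.trans (by gcongr)
      have h4 := mul_le_mul_of_nonneg_left h3 (by positivity : 0 ≤ J / 2 * n)
      have h5 : J / 2 * n * (2 / J * |t| ^ p / n + C₁ * n ^ θ) =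
          |t| ^ p + J / 2 * C₁ * (n * n ^ θ) := by
        field_simp
      linarith
  -- `U + Q` bounds the logarithm of the unnormalized exponential moment from above and `-L` bounds
  -- `log Z` from below. Each of `U` and `L` contributes `J * S / 2`.
  set U : ℝ := c + (n * I + J * S) / 2 + J / 2 * C₁ * (n * n ^ θ) with hU
  set L : ℝ := v + (n * I + J * (n + S)) / 2 with hL
  set B : ℝ := U + Q + L with hB
  have hB0 : 0 ≤ B := by positivity
  -- Restricting the integral to `[0, 1]` costs nothing in length and gives `|t| ^ r ≤ 1` and `V t ≤
  -- v`.
  have hlow : ENNReal.ofReal (Real.exp (-L)) ≤ marg {x} b ξ := by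
    rw [marg_singleton]
    calc ENNReal.ofReal (Real.exp (-L))
        = ∫⁻ _ in Set.Icc (0 : ℝ) 1, ENNReal.ofReal (Real.exp (-L)) := by simp
      _ ≤ ∫⁻ t in Set.Icc (0 : ℝ) 1, b (Function.update ξ x t) := by
          refine setLIntegral_mono' measurableSet_Icc fun t ht => ?_
          refine ENNReal.ofReal_le_ofReal (Real.exp_le_exp.2 (neg_le_neg ?_))
          rw [energy_singleton_update]
          have h1 := (abs_le.1 (hpair t)).2
          have h2 := (abs_le.1 (hv t ht)).2
          have h3 : |t| ^ r ≤ 1 := by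
            rw [abs_of_nonneg ht.1]
            exact Real.rpow_le_one ht.1 ht.2 hr.le
          have h4 := mul_le_mul_of_nonneg_left h3 (mul_nonneg hJ.le hn0)
          rw [hL]
          linarith
      _ ≤ ∫⁻ t, b (Function.update ξ x t) := setLIntegral_le_lintegral _ _
  have hupp : marg {x} (fun ω => ENNReal.ofReal (Real.exp (|ω x| ^ p)) * b ω) ξ ≤
      ENNReal.ofReal (Real.exp (U + Q)) := by
    rw [marg_singleton]
    calc ∫⁻ t, ENNReal.ofReal (Real.exp (|Function.update ξ x t x| ^ p)) * b (Function.update ξ x t)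
        ≤ ∫⁻ t, ENNReal.ofReal (Real.exp U) *
            ENNReal.ofReal (Real.exp (2 * |t| ^ p - a * |t| ^ q)) := by
          refine lintegral_mono fun t => ?_
          simp only [hb, boltzmann]
          rw [← ENNReal.ofReal_mul (Real.exp_pos _).le, ← ENNReal.ofReal_mul (Real.exp_pos _).le,
            ← Real.exp_add, ← Real.exp_add]
          refine ENNReal.ofReal_le_ofReal (Real.exp_le_exp.2 ?_)
          rw [energy_singleton_update, Function.update_self]
          have h1 := (abs_le.1 (hpair t)).1
          have h2 := h.le_self t
          have h3 := hyoung t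
          rw [hU]
          linarith
      _ = ENNReal.ofReal (Real.exp U) * ENNReal.ofReal Q := by
          rw [lintegral_const_mul' _ _ ENNReal.ofReal_ne_top,
            ofReal_integral_eq_lintegral_ofReal hQi (ae_of_all _ fun t => (Real.exp_pos _).le)]
      _ ≤ ENNReal.ofReal (Real.exp (U + Q)) := by
          rw [← ENNReal.ofReal_mul (Real.exp_pos _).le, Real.exp_add U Q]
          refine ENNReal.ofReal_le_ofReal (mul_le_mul_of_nonneg_left ?_ (Real.exp_pos _).le)
          linarith [Real.add_one_le_exp Q]
  have hf1 : Measurable fun ω : X → ℝ => ENNReal.ofReal (|ω x| ^ p) := by fun_prop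
  -- Integrate `s ≤ B + exp (s - B)` with `s = |ω x| ^ p`; since `B = U + Q + L`, the exponential
  -- part is at most `exp (-L) ≤ Z`.
  have hmain : marg {x} (fun ω => ENNReal.ofReal (|ω x| ^ p) * b ω) ξ ≤
      (ENNReal.ofReal B + 1) * marg {x} b ξ := by
    have h1 : marg {x} (fun ω => ENNReal.ofReal (|ω x| ^ p) * b ω) ξ ≤
        marg {x} (fun ω => ENNReal.ofReal B * b ω +
          ENNReal.ofReal (Real.exp (-B)) * (ENNReal.ofReal (Real.exp (|ω x| ^ p)) * b ω)) ξ := by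
      refine lintegral_mono fun u => ?_
      set ω := glue {x} u ξ
      show ENNReal.ofReal (|ω x| ^ p) * b ω ≤ ENNReal.ofReal B * b ω +
          ENNReal.ofReal (Real.exp (-B)) * (ENNReal.ofReal (Real.exp (|ω x| ^ p)) * b ω)
      rw [← mul_assoc, ← add_mul, ← ENNReal.ofReal_mul (Real.exp_pos _).le, ← Real.exp_add,
        ← ENNReal.ofReal_add hB0 (Real.exp_pos _).le]
      refine mul_le_mul_left (ENNReal.ofReal_le_ofReal ?_) _
      linarith [Real.add_one_le_exp (-B + |ω x| ^ p)]
    refine h1.trans ?_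
    have hbg : Measurable fun u => b (glue {x} u ξ) := hbm.comp (measurable_glue_left {x} ξ)
    rw [marg, lintegral_add_left (hbg.const_mul _),
      lintegral_const_mul' _ _ ENNReal.ofReal_ne_top,
      lintegral_const_mul' _ _ ENNReal.ofReal_ne_top, add_mul, one_mul]
    refine add_le_add le_rfl ?_
    calc ENNReal.ofReal (Real.exp (-B)) *
          marg {x} (fun ω => ENNReal.ofReal (Real.exp (|ω x| ^ p)) * b ω) ξ
        ≤ ENNReal.ofReal (Real.exp (-B)) * ENNReal.ofReal (Real.exp (U + Q)) := by gcongr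
      _ = ENNReal.ofReal (Real.exp (-L)) := by
          rw [← ENNReal.ofReal_mul (Real.exp_pos _).le, ← Real.exp_add]
          congr 2
          rw [hB]; ring
      _ ≤ marg {x} b ξ := hlow
  rw [h.lintegral_gibbsSpec {x} ξ hf1]
  calc (marg {x} b ξ)⁻¹ * marg {x} (fun ω => ENNReal.ofReal (|ω x| ^ p) * b ω) ξ
      ≤ (marg {x} b ξ)⁻¹ * ((ENNReal.ofReal B + 1) * marg {x} b ξ) := by gcongr
    _ = ENNReal.ofReal B + 1 := by
        rw [mul_comm, mul_assoc, ENNReal.mul_inv_cancel (h.marg_boltzmann_ne_zero {x} ξ)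
          (h.marg_boltzmann_ne_top {x} ξ), mul_one]
    _ = ENNReal.ofReal (B + 1) := by
        rw [ENNReal.ofReal_add hB0 zero_le_one, ENNReal.ofReal_one]
    _ ≤ _ := by
        refine ENNReal.ofReal_le_ofReal ?_
        -- Young's inequality is applied to each neighbour at scale `n(x) n(y)`; the errors add up
        -- to a multiple of `m_θ(x)`.
        have hJS : J * S ≤ δ * (∑ y ∈ G.neighborFinset x, |ξ y| ^ p / (n * G.degree y)) +
            J * C₂ * m := by
          rw [hS, Finset.mul_sum, Finset.mul_sum, hm, degreeSum, Finset.mul_sum,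
            ← Finset.sum_add_distrib]
          refine Finset.sum_le_sum fun y hy => ?_
          rw [SimpleGraph.mem_neighborFinset] at hy
          have hx1 : (1 : ℝ) ≤ G.degree x := by
            exact_mod_cast (G.degree_pos_iff_exists_adj x).2 ⟨y, hy⟩
          have hy1 : (1 : ℝ) ≤ G.degree y := by
            exact_mod_cast (G.degree_pos_iff_exists_adj y).2 ⟨x, hy.symm⟩
          have hxy : (1 : ℝ) ≤ n * G.degree y := one_le_mul_of_one_le_of_one_le hx1 hy1
          have h1 := hyoung₂ _ hxy |ξ y| (abs_nonneg _)
          have h2 : (n * G.degree y) ^ (r / (p - r)) ≤ (n * G.degree y) ^ θ :=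
            Real.rpow_le_rpow_of_exponent_le hxy hexp
          have h3 : |ξ y| ^ r ≤ δ / J * |ξ y| ^ p / (n * G.degree y) +
              C₂ * (n * G.degree y) ^ θ := h1.trans (by gcongr)
          have h4 := mul_le_mul_of_nonneg_left h3 hJ.le
          have h5 : J * (δ / J * |ξ y| ^ p / (n * G.degree y) + C₂ * (n * G.degree y) ^ θ) =
              δ * (|ξ y| ^ p / (n * G.degree y)) + J * C₂ * (n * G.degree y) ^ θ := by
            field_simp
          linarith
        have hm0 : 0 ≤ m := hn0.trans hm1
        have e1 : I * n ≤ I * m := by gcongr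
        have e2 : J / 2 * n ≤ J / 2 * m := by gcongr
        have e3 : J / 2 * C₁ * (n * n ^ θ) ≤ J / 2 * C₁ * m := by gcongr
        have e4 : 0 ≤ (c + Q + v + 1) * m := by positivity
        have e5 : 0 ≤ I + J / 2 + J / 2 * C₁ + J * C₂ := by positivity
        have e6 : B + 1 = (c + Q + v + 1) + I * n + J / 2 * n + J / 2 * C₁ * (n * n ^ θ) +
            J * S := by rw [hB, hU, hL]; ring
        rw [e6]
        linarith

end Moments

/-! ### Comparison of the weights. -/

section Weight

variable {X : Type*} {G : SimpleGraph X}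

lemma weight_pos (G : SimpleGraph X) (o : X) (α : ℝ) (x : X) : 0 < weight G o α x :=
  Real.exp_pos _

lemma weight_le_of_adj (hG : G.Connected) (o : X) {α : ℝ} (hα : 0 ≤ α) {x y : X}
    (h : G.Adj x y) : weight G o α x ≤ Real.exp α * weight G o α y := by
  rw [weight, weight, ← Real.exp_add]
  refine Real.exp_le_exp.2 ?_
  have h1 : G.dist o y ≤ G.dist o x + 1 := by
    have := hG.dist_triangle (u := o) (v := x) (w := y)
    rwa [SimpleGraph.dist_eq_one_iff_adj.2 h] at this
  have h2 : (G.dist o y : ℝ) ≤ G.dist o x + 1 := by exact_mod_cast h1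
  nlinarith

lemma weight_anti (G : SimpleGraph X) (o : X) {α β : ℝ} (h : α ≤ β) (x : X) :
    weight G o β x ≤ weight G o α x := by
  refine Real.exp_le_exp.2 ?_
  have : (0 : ℝ) ≤ G.dist o x := Nat.cast_nonneg _
  nlinarith

end Weight

/-- The absorption step: doubling the hypothesis and cancelling one `S`, which in `[0, ∞]` requires
`S` to be finite. -/
lemma le_add_of_le_add_half {S T D : ℝ≥0∞} (hS : S ≠ ∞) (h : S ≤ D + 2⁻¹ * (S + T)) :
    S ≤ D + D + T := by
  have h2 : S + S ≤ S + (D + D + T) := by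
    calc S + S ≤ (D + 2⁻¹ * (S + T)) + (D + 2⁻¹ * (S + T)) := add_le_add h h
      _ = D + D + (2⁻¹ + 2⁻¹) * (S + T) := by ring
      _ = S + (D + D + T) := by rw [ENNReal.inv_two_add_inv_two]; ring
  exact (ENNReal.add_le_add_iff_left hS).1 h2

/-! ### Summation of the one-point estimate over a finite volume. -/

section Recursion

variable {X : Type*} {G : SimpleGraph X} [G.LocallyFinite] {W : ℝ → ℝ → ℝ} {V : ℝ → ℝ}
  {r q I J a c : ℝ}

lemma degreeSum_nonneg (θ : ℝ) (x : X) : 0 ≤ degreeSum G θ x :=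
  Finset.sum_nonneg fun _ _ => by positivity

/-- With at least two vertices, connectedness forces `1 ≤ n(x) ≤ m_θ(x)`, so the constant is
dominated by `m_θ`. On a single vertex `m_θ = 0`, but the sum is finite. -/
lemma tsum_one_add_degreeSum_lt_top (hG : G.Connected) (o : X) {α θ : ℝ} (hθ : 0 < θ)
    (h : bigTheta G o α θ < ∞) :
    ∑' x, ENNReal.ofReal ((1 + degreeSum G θ x) * weight G o α x) < ∞ := by
  rcases subsingleton_or_nontrivial X with hX | hX
  · have := Fintype.ofSubsingleton o
    rw [tsum_fintype]
    exact ENNReal.sum_lt_top.2 fun _ _ => ENNReal.ofReal_lt_top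
  · refine lt_of_le_of_lt (ENNReal.tsum_le_tsum (g := fun x =>
      2 * ENNReal.ofReal (degreeSum G θ x * weight G o α x)) fun x => ?_) ?_
    · rw [← ENNReal.ofReal_ofNat 2, ← ENNReal.ofReal_mul zero_le_two, ← mul_assoc]
      have h1 : (1 : ℝ) ≤ G.degree x := by
        exact_mod_cast hG.preconnected.degree_pos_of_nontrivial x
      have h2 := degree_le_degreeSum (G := G) hθ x
      refine ENNReal.ofReal_le_ofReal (mul_le_mul_of_nonneg_right ?_ (weight_pos G o α x).le)
      linarith
    · rw [ENNReal.tsum_mul_left]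
      exact ENNReal.mul_lt_top ENNReal.ofNat_lt_top h

lemma tsum_weight_lt_top (hG : G.Connected) (o : X) {α θ : ℝ} (hθ : 0 < θ)
    (h : bigTheta G o α θ < ∞) : ∑' x, ENNReal.ofReal (weight G o α x) < ∞ := by
  refine lt_of_le_of_lt (ENNReal.tsum_le_tsum fun x => ENNReal.ofReal_le_ofReal ?_)
    (tsum_one_add_degreeSum_lt_top hG o hθ h)
  refine le_mul_of_one_le_left (weight_pos G o α x).le ?_
  linarith [degreeSum_nonneg (G := G) θ x]

open Classical in
lemma tsum_ite_mem_finset (s : Finset X) (f : X → ℝ≥0∞) :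
    ∑' y, (if y ∈ s then f y else 0) = ∑ y ∈ s, f y := by
  rw [tsum_eq_sum (s := s) fun b hb => if_neg hb]
  exact Finset.sum_congr rfl fun y hy => if_pos hy

/-- Summation over edges with the symmetric weights `1 / (n(x) n(y))`. -/
lemma sum_sum_neighborFinset_le (Λ : Finset X) (f : X → ℝ≥0∞) :
    ∑ x ∈ Λ, ∑ y ∈ G.neighborFinset x,
      ENNReal.ofReal (1 / ((G.degree x : ℝ) * G.degree y)) * f y ≤ ∑' y, f y := by
  classical
  calc ∑ x ∈ Λ, ∑ y ∈ G.neighborFinset x,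
        ENNReal.ofReal (1 / ((G.degree x : ℝ) * G.degree y)) * f y
      ≤ ∑' x, ∑ y ∈ G.neighborFinset x,
        ENNReal.ofReal (1 / ((G.degree x : ℝ) * G.degree y)) * f y := ENNReal.sum_le_tsum _
    _ = ∑' x, ∑' y, if G.Adj x y then
          ENNReal.ofReal (1 / ((G.degree x : ℝ) * G.degree y)) * f y else 0 := by
        refine tsum_congr fun x => ?_
        rw [← tsum_ite_mem_finset]
        simp only [SimpleGraph.mem_neighborFinset]
    _ = ∑' y, ∑' x, if G.Adj x y then
          ENNReal.ofReal (1 / ((G.degree x : ℝ) * G.degree y)) * f y else 0 :=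
        ENNReal.tsum_comm
    _ = ∑' y, ∑ x ∈ G.neighborFinset y,
          ENNReal.ofReal (1 / ((G.degree x : ℝ) * G.degree y)) * f y := by
        refine tsum_congr fun y => ?_
        rw [← tsum_ite_mem_finset]
        simp only [SimpleGraph.mem_neighborFinset, G.adj_comm]
    -- After the exchange, `f y` carries the coefficient `∑_{x ∼ y} 1 / (n(x) n(y))`, at most `n(y)`
    -- terms `1 / n(y)`.
    _ ≤ ∑' y, f y := by
        refine ENNReal.tsum_le_tsum fun y => ?_
        rw [← Finset.sum_mul]
        refine mul_le_of_le_one_left' ?_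
        rw [← ENNReal.ofReal_sum_of_nonneg fun _ _ => by positivity]
        rw [← ENNReal.ofReal_one]
        refine ENNReal.ofReal_le_ofReal ?_
        calc ∑ x ∈ G.neighborFinset y, 1 / ((G.degree x : ℝ) * G.degree y)
            ≤ ∑ x ∈ G.neighborFinset y, 1 / (G.degree y : ℝ) := by
              refine Finset.sum_le_sum fun x hx => ?_
              rw [SimpleGraph.mem_neighborFinset] at hx
              have h1 : (1 : ℝ) ≤ G.degree x := by
                exact_mod_cast (G.degree_pos_iff_exists_adj x).2 ⟨y, hx.symm⟩
              have h2 : (0 : ℝ) < G.degree y := by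
                exact_mod_cast (G.degree_pos_iff_exists_adj y).2 ⟨x, hx⟩
              exact one_div_le_one_div_of_le h2 (le_mul_of_one_le_left h2.le h1)
          _ = (G.degree y : ℝ) * (1 / (G.degree y : ℝ)) := by
              rw [Finset.sum_const, nsmul_eq_mul, SimpleGraph.card_neighborFinset_eq_degree]
          _ ≤ 1 := by rw [mul_one_div]; exact div_self_le_one _

lemma IsStablePotential.lintegral_rpow_gibbsSpec_lt_top [Countable X]
    (h : IsStablePotential W V r q I J a c) (Λ : Finset X) (ξ : X → ℝ) {p : ℝ} (hrp : r < p)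
    (hpq : p < q) {x : X} (hx : x ∈ Λ) :
    ∫⁻ ω, ENNReal.ofReal (|ω x| ^ p) ∂gibbsSpec G W V Λ ξ < ∞ := by
  rw [h.lintegral_gibbsSpec Λ ξ (by fun_prop)]
  refine ENNReal.mul_lt_top (ENNReal.inv_lt_top.2
    (pos_iff_ne_zero.2 (h.marg_boltzmann_ne_zero Λ ξ))) (lt_of_le_of_lt (lintegral_mono fun u => ?_)
    (h.marg_exp_mul_boltzmann_lt_top (G := G) Λ hrp hpq ξ))
  refine mul_le_mul_left (ENNReal.ofReal_le_ofReal ?_) _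
  have h1 : |glue Λ u ξ x| ^ p ≤ ∑ z ∈ Λ, |glue Λ u ξ z| ^ p :=
    Finset.single_le_sum (f := fun z => |glue Λ u ξ z| ^ p) (fun _ _ => by positivity) hx
  linarith [Real.add_one_le_exp (∑ z ∈ Λ, |glue Λ u ξ z| ^ p)]

/-- Weighted moments of the local specification, uniformly in the volume. -/
lemma IsStablePotential.exists_sum_lintegral_gibbsSpec_le [Countable X]
    (h : IsStablePotential W V r q I J a c) (hG : G.Connected) (o : X) {θ p α : ℝ} (hθ : 0 < θ)
    (hp : r + r / θ ≤ p) (hpq : p < q) (hα : 0 ≤ α) (hΘ : bigTheta G o α θ < ∞) :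
    ∃ D : NNReal, ∀ (Λ : Finset X) (ξ : X → ℝ),
      ∑ x ∈ Λ, ∫⁻ ω, ENNReal.ofReal (|ω x| ^ p * weight G o α x) ∂gibbsSpec G W V Λ ξ ≤
        D + ∑' x : {x // x ∉ Λ}, ENNReal.ofReal (|ξ x| ^ p * weight G o α x) := by
  classical
  have hrp : r < p := by
    have := div_pos h.r_pos hθ
    linarith
  -- `exp (-α)` pays for replacing `w_α(x)` by `w_α(y)` at a neighbour, and `1 / 2` makes the
  -- recursion contractive.
  set δ : ℝ := Real.exp (-α) / 2 with hδ
  have hδ0 : 0 < δ := by positivity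
  obtain ⟨C, hC, hle⟩ := h.exists_lintegral_gibbsSpec_singleton_le (G := G) hθ hp hpq hδ0
  set D₀ : ℝ≥0∞ := ENNReal.ofReal C *
    ∑' x, ENNReal.ofReal ((1 + degreeSum G θ x) * weight G o α x) with hD₀
  have hD₀t : D₀ ≠ ∞ :=
    ENNReal.mul_ne_top ENNReal.ofReal_ne_top (tsum_one_add_degreeSum_lt_top hG o hθ hΘ).ne
  refine ⟨(D₀ + D₀).toNNReal, fun Λ ξ => ?_⟩
  rw [ENNReal.coe_toNNReal (ENNReal.add_ne_top.2 ⟨hD₀t, hD₀t⟩)]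
  have := h.isProbabilityMeasure_gibbsSpec (G := G) Λ ξ
  set M : X → ℝ≥0∞ := fun x => ∫⁻ ω, ENNReal.ofReal (|ω x| ^ p) ∂gibbsSpec G W V Λ ξ with hM
  have hmeas : ∀ x, Measurable fun ω : X → ℝ => ENNReal.ofReal (|ω x| ^ p) := fun x => by fun_prop
  set f : X → ℝ≥0∞ := fun x =>
    ∫⁻ ω, ENNReal.ofReal (|ω x| ^ p * weight G o α x) ∂gibbsSpec G W V Λ ξ with hf
  have hfM : ∀ x, f x = M x * ENNReal.ofReal (weight G o α x) := fun x => by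
    simp only [hf, hM]
    rw [← lintegral_mul_const' _ _ ENNReal.ofReal_ne_top]
    simp only [ENNReal.ofReal_mul (Real.rpow_nonneg (abs_nonneg _) _)]
  have hout : ∀ x ∉ Λ, f x = ENNReal.ofReal (|ξ x| ^ p * weight G o α x) := fun x hx =>
    h.lintegral_gibbsSpec_of_congr Λ
      (f := fun ω => ENNReal.ofReal (|ω x| ^ p * weight G o α x)) (by fun_prop)
      (fun u ξ => by simp only [glue_of_notMem u ξ hx]) ξ
  have hrec : ∀ x ∈ Λ, f x ≤ ENNReal.ofReal (C * ((1 + degreeSum G θ x) * weight G o α x)) +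
      2⁻¹ * ∑ y ∈ G.neighborFinset x,
        ENNReal.ofReal (1 / ((G.degree x : ℝ) * G.degree y)) * f y := by
    intro x hx
    have h1 : M x ≤ ENNReal.ofReal (C * (1 + degreeSum G θ x)) +
        ∑ y ∈ G.neighborFinset x,
          ENNReal.ofReal (δ / ((G.degree x : ℝ) * G.degree y)) * M y := by
      have hm0 := degreeSum_nonneg (G := G) θ x
      simp only [hM]
      -- Consistency inserts `π_x` under `π_Λ`, so the one-point bound can be averaged.
      rw [← h.lintegral_lintegral_gibbsSpec (Finset.singleton_subset_iff.2 hx) ξ (hmeas x)]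
      refine (lintegral_mono fun η => hle x η).trans (le_of_eq ?_)
      have e : ∀ η : X → ℝ, ENNReal.ofReal (C * (1 + degreeSum G θ x) +
          δ * ∑ y ∈ G.neighborFinset x, |η y| ^ p / ((G.degree x : ℝ) * G.degree y)) =
          ENNReal.ofReal (C * (1 + degreeSum G θ x)) + ∑ y ∈ G.neighborFinset x,
          ENNReal.ofReal (δ / ((G.degree x : ℝ) * G.degree y)) * ENNReal.ofReal (|η y| ^ p) := by
        intro η
        rw [ENNReal.ofReal_add (by positivity) (mul_nonneg hδ0.le
          (Finset.sum_nonneg fun _ _ => by positivity)), Finset.mul_sum,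
          ENNReal.ofReal_sum_of_nonneg fun _ _ => by positivity]
        congr 1
        refine Finset.sum_congr rfl fun y _ => ?_
        rw [← ENNReal.ofReal_mul (by positivity)]
        congr 1
        ring
      simp only [e]
      rw [lintegral_add_left measurable_const, lintegral_const, measure_univ, mul_one,
        lintegral_finsetSum _ fun y _ => (hmeas y).const_mul _]
      congr 1
      exact Finset.sum_congr rfl fun y _ => lintegral_const_mul' _ _ ENNReal.ofReal_ne_top
    rw [hfM]
    refine (mul_le_mul_left h1 _).trans ?_
    rw [add_mul, ← ENNReal.ofReal_mul (mul_nonneg hC (by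
      linarith [degreeSum_nonneg (G := G) θ x])), mul_assoc, Finset.sum_mul, Finset.mul_sum]
    refine add_le_add le_rfl (Finset.sum_le_sum fun y hy => ?_)
    rw [SimpleGraph.mem_neighborFinset] at hy
    have hw := weight_le_of_adj hG o hα hy
    have h2 : (2⁻¹ : ℝ≥0∞) = ENNReal.ofReal (1 / 2) := by
      rw [one_div, ENNReal.ofReal_inv_of_pos two_pos, ENNReal.ofReal_ofNat]
    have h3 : δ / ((G.degree x : ℝ) * G.degree y) * weight G o α x ≤
        1 / 2 * (1 / ((G.degree x : ℝ) * G.degree y) * weight G o α y) := by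
      have h4 := mul_le_mul_of_nonneg_left hw hδ0.le
      have h5 : δ * (Real.exp α * weight G o α y) = 1 / 2 * weight G o α y := by
        rw [hδ, Real.exp_neg]
        field_simp
      rw [h5] at h4
      have h6 : (0 : ℝ) ≤ 1 / ((G.degree x : ℝ) * G.degree y) := by positivity
      have := mul_le_mul_of_nonneg_left h4 h6
      calc δ / ((G.degree x : ℝ) * G.degree y) * weight G o α x
          = 1 / ((G.degree x : ℝ) * G.degree y) * (δ * weight G o α x) := by ring
        _ ≤ 1 / ((G.degree x : ℝ) * G.degree y) * (1 / 2 * weight G o α y) := this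
        _ = _ := by ring
    rw [hfM, h2]
    have h4 := ENNReal.ofReal_le_ofReal h3
    rw [ENNReal.ofReal_mul (by positivity), ENNReal.ofReal_mul (by positivity),
      ENNReal.ofReal_mul (by positivity)] at h4
    refine le_trans (le_of_eq ?_) ((mul_le_mul_right h4 (M y)).trans (le_of_eq ?_))
    · rw [mul_left_comm, mul_assoc]
    · generalize M y = m
      ring
  set S : ℝ≥0∞ := ∑ x ∈ Λ, f x with hS
  set T : ℝ≥0∞ := ∑' x : {x // x ∉ Λ}, ENNReal.ofReal (|ξ x| ^ p * weight G o α x) with hT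
  have hSt : S ≠ ∞ := by
    refine (ENNReal.sum_lt_top.2 fun x hx => ?_).ne
    rw [hfM]
    exact ENNReal.mul_lt_top (h.lintegral_rpow_gibbsSpec_lt_top Λ ξ hrp hpq hx)
      ENNReal.ofReal_lt_top
  have htot : ∑' x, f x = S + T := by
    have h1 : ∑' x : {x // x ∉ Λ}, f x = T := tsum_congr fun x => hout x.1 x.2
    rw [← h1]
    exact (ENNReal.sum_add_tsum_compl Λ f).symm
  have hsum : S ≤ D₀ + 2⁻¹ * (S + T) := by
    refine (Finset.sum_le_sum hrec).trans ?_
    rw [Finset.sum_add_distrib, ← Finset.mul_sum, ← htot]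
    refine add_le_add ?_ (mul_le_mul_right (sum_sum_neighborFinset_le Λ f) _)
    simp only [ENNReal.ofReal_mul hC]
    rw [← Finset.mul_sum]
    exact mul_le_mul_right (ENNReal.sum_le_tsum _) _
  exact le_add_of_le_add_half hSt hsum

end Recursion

/-! ### Weighted moments of Gibbs measures -/

/-- The modular `∑ₓ |ω(x)|^p w_α(x)` with values in `[0, ∞]`. -/
noncomputable def lpModular {X : Type*} (G : SimpleGraph X) (o : X) (p α : ℝ) (ω : X → ℝ) :
    ℝ≥0∞ :=
  ∑' x, ENNReal.ofReal (|ω x| ^ p * weight G o α x)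

lemma measurable_lpModular {X : Type*} [Countable X] (G : SimpleGraph X) (o : X) (p α : ℝ) :
    Measurable (lpModular G o p α) :=
  Measurable.tsum fun x => by fun_prop

lemma mem_lpSet_iff {X : Type*} {G : SimpleGraph X} {o : X} {p α : ℝ} {ω : X → ℝ} :
    ω ∈ lpSet G o p α ↔ lpModular G o p α ω ≠ ∞ := by
  have h0 : ∀ x, 0 ≤ |ω x| ^ p * weight G o α x := fun x =>
    mul_nonneg (Real.rpow_nonneg (abs_nonneg _) _) (weight_pos G o α x).le
  constructor
  · intro h
    rw [lpModular, ← ENNReal.ofReal_tsum_of_nonneg h0 h]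
    exact ENNReal.ofReal_ne_top
  · intro h
    have := ENNReal.summable_toReal h
    simp only [ENNReal.toReal_ofReal (h0 _)] at this
    exact this

section GibbsMoments

variable {X : Type*} [Countable X] {G : SimpleGraph X} [G.LocallyFinite] {W : ℝ → ℝ → ℝ}
  {V : ℝ → ℝ} {r q I J a c : ℝ}

/-- A Gibbs measure inherits uniform bounds on the moments of the local specification. -/
lemma IsStablePotential.lintegral_lpModular_le_of_bind_eq
    (h : IsStablePotential W V r q I J a c) {o : X} {p α : ℝ} {D : NNReal}
    (hD : ∀ (Λ : Finset X) (ξ : X → ℝ),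
      ∑ x ∈ Λ, ∫⁻ ω, ENNReal.ofReal (|ω x| ^ p * weight G o α x) ∂gibbsSpec G W V Λ ξ ≤
        D + ∑' x : {x // x ∉ Λ}, ENNReal.ofReal (|ξ x| ^ p * weight G o α x))
    {μ : Measure (X → ℝ)} [IsProbabilityMeasure μ]
    (hμ : ∀ Λ : Finset X, Λ.Nonempty → μ.bind (gibbsSpec G W V Λ) = μ)
    (hfin : ∀ᵐ ξ ∂μ, lpModular G o p α ξ ≠ ∞) :
    ∫⁻ ω, lpModular G o p α ω ∂μ ≤ D := by
  set f : X → (X → ℝ) → ℝ≥0∞ := fun x ω => ENNReal.ofReal (|ω x| ^ p * weight G o α x) with hf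
  have hfm : ∀ x, Measurable (f x) := fun x => by simp only [hf]; fun_prop
  have hFm : ∀ Δ : Finset X, Measurable fun ω => ∑ x ∈ Δ, f x ω := fun Δ =>
    Finset.measurable_fun_sum _ fun x _ => hfm x
  have hTm : ∀ Λ : Finset X, Measurable fun ξ : X → ℝ => ∑' x : {x // x ∉ Λ}, f x ξ := fun Λ =>
    Measurable.tsum fun x => hfm x
  -- The boundary sum is only known to be finite almost surely, not integrable; truncation at `N`
  -- makes dominated convergence available, and `N` is removed later by monotone convergence.
  have htrunc : ∀ (Δ : Finset X), Δ.Nonempty → ∀ N : ℕ,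
      ∫⁻ ω, (∑ x ∈ Δ, f x ω) ⊓ (N : ℝ≥0∞) ∂μ ≤ D := by
    intro Δ hΔ N
    have hle : ∀ Λ : Finset X, Δ ⊆ Λ → ∫⁻ ω, (∑ x ∈ Δ, f x ω) ⊓ (N : ℝ≥0∞) ∂μ ≤
        ∫⁻ ξ, (D + ∑' x : {x // x ∉ Λ}, f x ξ) ⊓ (N : ℝ≥0∞) ∂μ := by
      intro Λ hΛ
      conv_lhs => rw [← hμ Λ (hΔ.mono hΛ)]
      rw [Measure.lintegral_bind (h.measurable_gibbsSpec Λ).aemeasurable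
        ((hFm Δ).min measurable_const).aemeasurable]
      refine lintegral_mono fun ξ => ?_
      have := h.isProbabilityMeasure_gibbsSpec (G := G) Λ ξ
      refine le_inf ?_ ?_
      · refine (lintegral_mono fun ω => inf_le_left.trans
          (Finset.sum_le_sum_of_subset hΛ)).trans ?_
        rw [lintegral_finsetSum _ fun x _ => hfm x]
        exact hD Λ ξ
      · refine (lintegral_mono fun ω => inf_le_right).trans ?_
        simp
    have hlim : Tendsto (fun Λ : Finset X =>
        ∫⁻ ξ, (D + ∑' x : {x // x ∉ Λ}, f x ξ) ⊓ (N : ℝ≥0∞) ∂μ) atTop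
        (𝓝 (∫⁻ _, ((D : ℝ≥0∞) + 0) ⊓ (N : ℝ≥0∞) ∂μ)) := by
      refine tendsto_lintegral_filter_of_dominated_convergence (fun _ => (N : ℝ≥0∞))
        (Eventually.of_forall fun Λ => (measurable_const.add (hTm Λ)).min measurable_const)
        (Eventually.of_forall fun Λ => ae_of_all _ fun ξ => inf_le_right) (by simp) ?_
      filter_upwards [hfin] with ξ hξ
      have h1 := ENNReal.tendsto_tsum_compl_atTop_zero (f := fun x => f x ξ) hξ
      exact (tendsto_const_nhds.add h1).min tendsto_const_nhds
    have hlim' : ∫⁻ ω, (∑ x ∈ Δ, f x ω) ⊓ (N : ℝ≥0∞) ∂μ ≤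
        ∫⁻ _, ((D : ℝ≥0∞) + 0) ⊓ (N : ℝ≥0∞) ∂μ :=
      ge_of_tendsto hlim (by filter_upwards [eventually_ge_atTop Δ] with Λ hΛ using hle Λ hΛ)
    refine hlim'.trans ((lintegral_mono (g := fun _ => (D : ℝ≥0∞)) fun _ => ?_).trans ?_)
    · exact inf_le_left.trans (by simp)
    · simp
  have hfull : ∀ Δ : Finset X, ∑ x ∈ Δ, ∫⁻ ω, f x ω ∂μ ≤ D := by
    intro Δ
    rcases Δ.eq_empty_or_nonempty with rfl | hΔ
    · simp
    rw [← lintegral_finsetSum _ fun x _ => hfm x]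
    have hsup : ∀ ω, ∑ x ∈ Δ, f x ω = ⨆ N : ℕ, (∑ x ∈ Δ, f x ω) ⊓ (N : ℝ≥0∞) := fun ω => by
      rw [← inf_iSup_eq, ENNReal.iSup_natCast, inf_top_eq]
    rw [lintegral_congr hsup, lintegral_iSup (fun N => (hFm Δ).min measurable_const) fun M N hMN ω =>
      inf_le_inf_left _ (Nat.cast_le.2 hMN)]
    exact iSup_le (htrunc Δ hΔ)
  have : ∫⁻ ω, lpModular G o p α ω ∂μ = ∑' x, ∫⁻ ω, f x ω ∂μ :=
    lintegral_tsum fun x => (hfm x).aemeasurable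
  rw [this, ENNReal.tsum_eq_iSup_sum]
  exact iSup_le hfull

/-- With zero boundary condition the exterior terms vanish on both sides. These measures are the
approximants in the existence proof. -/
lemma IsStablePotential.lintegral_lpModular_gibbsSpec_zero_le
    (h : IsStablePotential W V r q I J a c) {o : X} {p α : ℝ} (hp : 0 < p) {D : NNReal}
    (hD : ∀ (Λ : Finset X) (ξ : X → ℝ),
      ∑ x ∈ Λ, ∫⁻ ω, ENNReal.ofReal (|ω x| ^ p * weight G o α x) ∂gibbsSpec G W V Λ ξ ≤
        D + ∑' x : {x // x ∉ Λ}, ENNReal.ofReal (|ξ x| ^ p * weight G o α x))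
    (Λ : Finset X) : ∫⁻ ω, lpModular G o p α ω ∂gibbsSpec G W V Λ 0 ≤ D := by
  have h1 : ∫⁻ ω, lpModular G o p α ω ∂gibbsSpec G W V Λ 0 =
      ∑' x, ∫⁻ ω, ENNReal.ofReal (|ω x| ^ p * weight G o α x) ∂gibbsSpec G W V Λ 0 :=
    lintegral_tsum fun x => (by fun_prop : Measurable fun ω : X → ℝ =>
      ENNReal.ofReal (|ω x| ^ p * weight G o α x)).aemeasurable
  have hout : ∀ x ∉ Λ,
      ∫⁻ ω, ENNReal.ofReal (|ω x| ^ p * weight G o α x) ∂gibbsSpec G W V Λ 0 = 0 := by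
    intro x hx
    rw [h.lintegral_gibbsSpec_of_congr Λ
      (f := fun ω => ENNReal.ofReal (|ω x| ^ p * weight G o α x)) (by fun_prop)
      (fun u ξ => by simp only [glue_of_notMem u ξ hx]) 0]
    simp [Real.zero_rpow hp.ne']
  rw [h1, tsum_eq_sum hout]
  simpa [Real.zero_rpow hp.ne'] using hD Λ 0

end GibbsMoments

/-! ### The space of tempered configurations -/

lemma abs_sub_rpow_le {p : ℝ} (hp : 0 ≤ p) (s t : ℝ) :
    |s - t| ^ p ≤ 2 ^ p * (|s| ^ p + |t| ^ p) := by
  have h1 : |s - t| ≤ 2 * max |s| |t| := by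
    have := abs_sub s t
    have := le_max_left |s| |t|
    have := le_max_right |s| |t|
    linarith
  have h2 : |s - t| ^ p ≤ 2 ^ p * (max |s| |t|) ^ p := by
    rw [← Real.mul_rpow zero_le_two (by positivity)]
    exact Real.rpow_le_rpow (abs_nonneg _) h1 hp
  refine h2.trans (mul_le_mul_of_nonneg_left ?_ (by positivity))
  have hs : 0 ≤ |s| ^ p := by positivity
  have ht : 0 ≤ |t| ^ p := by positivity
  rcases max_choice |s| |t| with h | h <;> rw [h] <;> linarith

section Topology

variable {X : Type*} {G : SimpleGraph X} {o : X}

lemma rpow_mul_weight_nonneg (p α : ℝ) (ω : X → ℝ) (x : X) :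
    0 ≤ |ω x| ^ p * weight G o α x :=
  mul_nonneg (Real.rpow_nonneg (abs_nonneg _) _) (weight_pos G o α x).le

lemma summable_sub {p α : ℝ} (hp : 0 ≤ p) {ω η : X → ℝ} (hω : ω ∈ lpSet G o p α)
    (hη : η ∈ lpSet G o p α) : Summable fun x => |ω x - η x| ^ p * weight G o α x := by
  refine Summable.of_nonneg_of_le (fun x => rpow_mul_weight_nonneg p α (ω - η) x) (fun x => ?_)
    ((Summable.add hω hη).mul_left (2 ^ p))
  have := mul_le_mul_of_nonneg_right (abs_sub_rpow_le hp (ω x) (η x)) (weight_pos G o α x).le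
  linarith

/-- The weights have finite total mass, so a larger exponent is the stronger condition, as is a
smaller `α`. This reduces temperedness to a cofinal sequence of pairs. -/
lemma mem_lpSet_of_lt {p p' α α' : ℝ} (hp : 0 < p) (hpp' : p < p') (hα : α' ≤ α)
    (hw : Summable (weight G o α)) {ω : X → ℝ} (hω : ω ∈ lpSet G o p' α') :
    ω ∈ lpSet G o p α := by
  obtain ⟨C, -, hC⟩ := exists_rpow_le_mul_rpow_add hp hpp' one_pos
  refine Summable.of_nonneg_of_le (fun x => rpow_mul_weight_nonneg p α ω x) (fun x => ?_)
    (Summable.add hω (hw.mul_left C))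
  have h1 := mul_le_mul_of_nonneg_right (hC |ω x| (abs_nonneg _)) (weight_pos G o α x).le
  have h2 := mul_le_mul_of_nonneg_left (weight_anti G o hα x)
    (Real.rpow_nonneg (abs_nonneg (ω x)) p')
  linarith

lemma lpModular_anti {p α α' : ℝ} (hα : α' ≤ α) (ω : X → ℝ) :
    lpModular G o p α ω ≤ lpModular G o p α' ω :=
  ENNReal.tsum_le_tsum fun x => ENNReal.ofReal_le_ofReal
    (mul_le_mul_of_nonneg_left (weight_anti G o hα x) (Real.rpow_nonneg (abs_nonneg _) _))

/-- On sets bounded in the modular of a larger exponent, the `L^p` distance is continuous with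
respect to pointwise convergence. -/
lemma continuousOn_tsum_sub {p p' α : ℝ} (hp : 0 < p) (hpp' : p < p')
    (hw : Summable (weight G o α)) {K : Set (X → ℝ)} {N : NNReal}
    (hK : ∀ ω ∈ K, lpModular G o p' α ω ≤ N) {η : X → ℝ} (hη : η ∈ lpSet G o p α) :
    ContinuousOn (fun ω : X → ℝ => ∑' x, |ω x - η x| ^ p * weight G o α x) K := by
  have hK' : ∀ ω ∈ K, ω ∈ lpSet G o p' α := fun ω hω =>
    mem_lpSet_iff.2 (ne_top_of_le_ne_top ENNReal.coe_ne_top (hK ω hω))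
  have hKN : ∀ ω ∈ K, ∑' x, |ω x| ^ p' * weight G o α x ≤ N := fun ω hω => by
    have := hK ω hω
    rw [lpModular, ← ENNReal.ofReal_tsum_of_nonneg (rpow_mul_weight_nonneg p' α ω) (hK' ω hω),
      ENNReal.ofReal_le_iff_le_toReal ENNReal.coe_ne_top] at this
    exact this
  -- Finite partial sums are continuous for pointwise convergence, so uniform smallness of the tails
  -- on `K` is enough.
  have hunif : TendstoUniformlyOn
      (fun (F : Finset X) (ω : X → ℝ) => ∑ x ∈ F, |ω x - η x| ^ p * weight G o α x)
      (fun ω => ∑' x, |ω x - η x| ^ p * weight G o α x) atTop K := by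
    rw [Metric.tendstoUniformlyOn_iff]
    intro ε hε
    -- Half of `ε` goes to the higher-exponent tail, bounded by `N` on `K`, and half to the tail of
    -- `C * w_α + |η| ^ p * w_α`, which does not depend on `ω`.
    set ε₁ : ℝ := ε / (2 * 2 ^ p * (N + 1)) with hε₁
    have hε₁0 : 0 < ε₁ := by positivity
    obtain ⟨C, -, hC⟩ := exists_rpow_le_mul_rpow_add hp hpp' hε₁0
    have hb : Summable fun x => C * weight G o α x + |η x| ^ p * weight G o α x :=
      Summable.add (hw.mul_left C) hη
    have htail := (tendsto_tsum_compl_atTop_zero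
      fun x => C * weight G o α x + |η x| ^ p * weight G o α x).eventually_lt_const
      (show (0 : ℝ) < ε / (2 * 2 ^ p) by positivity)
    filter_upwards [htail] with F hF ω hω
    have hs := summable_sub hp.le (mem_lpSet_of_lt hp hpp' le_rfl hw (hK' ω hω)) hη
    have h0 : ∀ x, 0 ≤ |ω x - η x| ^ p * weight G o α x := fun x =>
      rpow_mul_weight_nonneg p α (ω - η) x
    have hsplit := hs.sum_add_tsum_subtype_compl F
    have hdist : dist (∑' x, |ω x - η x| ^ p * weight G o α x)
        (∑ x ∈ F, |ω x - η x| ^ p * weight G o α x) =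
        ∑' x : {x // x ∉ F}, |ω x - η x| ^ p * weight G o α x := by
      rw [← hsplit, Real.dist_eq, add_sub_cancel_left]
      exact abs_of_nonneg (tsum_nonneg fun x => h0 x)
    rw [hdist]
    have hω' : Summable fun x : {x // x ∉ F} => |ω x| ^ p' * weight G o α x :=
      Summable.subtype (hK' ω hω) _
    have hb' : Summable fun x : {x // x ∉ F} =>
        C * weight G o α x + |η x| ^ p * weight G o α x := hb.subtype _
    have hωN : ∑' x : {x // x ∉ F}, |ω x| ^ p' * weight G o α x ≤ N :=
      (Summable.tsum_subtype_le _ _ (rpow_mul_weight_nonneg p' α ω) (hK' ω hω)).trans (hKN ω hω)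
    calc ∑' x : {x // x ∉ F}, |ω x - η x| ^ p * weight G o α x
        ≤ ∑' x : {x // x ∉ F}, 2 ^ p * (ε₁ * (|ω x| ^ p' * weight G o α x) +
            (C * weight G o α x + |η x| ^ p * weight G o α x)) := by
          refine Summable.tsum_le_tsum (fun x => ?_) (hs.subtype _)
            (((hω'.mul_left _).add hb').mul_left _)
          have h1 := mul_le_mul_of_nonneg_right (abs_sub_rpow_le hp.le (ω x) (η x))
            (weight_pos G o α x).le
          have h2 := mul_le_mul_of_nonneg_right (hC |ω x| (abs_nonneg _))
            (weight_pos G o α x).le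
          have h3 := mul_le_mul_of_nonneg_left h2 (by positivity : (0 : ℝ) ≤ 2 ^ p)
          linarith
      _ = 2 ^ p * (ε₁ * ∑' x : {x // x ∉ F}, |ω x| ^ p' * weight G o α x +
            ∑' x : {x // x ∉ F}, (C * weight G o α x + |η x| ^ p * weight G o α x)) := by
          rw [tsum_mul_left, Summable.tsum_add (hω'.mul_left _) hb', tsum_mul_left]
      _ < 2 ^ p * (ε₁ * (N + 1) + ε / (2 * 2 ^ p)) := by
          refine mul_lt_mul_of_pos_left (add_lt_add_of_le_of_lt ?_ hF) (by positivity)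
          exact mul_le_mul_of_nonneg_left (by linarith) hε₁0.le
      _ = ε := by
          rw [hε₁]
          field_simp
          ring
  refine hunif.continuousOn (Frequently.of_forall fun F => ?_)
  refine (continuous_finsetSum _ fun x _ => Continuous.mul ?_ continuous_const).continuousOn
  exact (((continuous_apply x).sub continuous_const).abs).rpow_const fun _ => Or.inr hp.le

/-- A map into the space of tempered configurations that restricts to the identity on `K` is
continuous on `K` with respect to pointwise convergence if `K` is bounded in larger exponents. -/
lemma continuousOn_temperedSpace {p₀ q a b : ℝ} (hp₀ : 0 < p₀)
    (hw : ∀ α ∈ Set.Ioc a b, Summable (weight G o α)) {K : Set (X → ℝ)}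
    (hK : ∀ p ∈ Set.Ico p₀ q, ∀ α ∈ Set.Ioc a b, ∃ p' > p, ∃ N : NNReal,
      ∀ ω ∈ K, lpModular G o p' α ω ≤ N)
    {φ : (X → ℝ) → TemperedSpace G o p₀ q a b} (hφ : ∀ ω ∈ K, (φ ω).1 = ω) :
    ContinuousOn φ K := by
  rw [continuousOn_iff_continuous_domRestrict]
  refine continuous_iInf_rng.2 fun p => continuous_iInf_rng.2 fun α => ?_
  refine continuous_induced_rng.2 (continuous_generateFrom_iff.2 ?_)
  rintro B ⟨η, ε, hε, rfl⟩
  obtain ⟨p', hpp', N, hN⟩ := hK p p.2 α α.2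
  have hp : 0 < (p : ℝ) := hp₀.trans_le p.2.1
  have hc := continuousOn_iff_continuous_domRestrict.1
    (continuousOn_tsum_sub hp hpp' (hw α α.2) hN η.2)
  have hc' := hc.rpow_const (p := 1 / (p : ℝ)) fun _ => Or.inr (by positivity)
  refine (congrArg IsOpen ?_).mpr ((isOpen_Iio (a := ε)).preimage hc')
  ext ω
  simp only [Set.mem_preimage, Set.mem_Iio, lpNorm, Function.comp_apply,
    Set.domRestrict_apply, TemperedSpace.toLp, hφ ω.1 ω.2, Pi.sub_apply]
  exact Iff.rfl

/-- Convergence in the space of tempered configurations implies pointwise convergence. -/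
lemma continuous_temperedSpace_val {p₀ q a b : ℝ} (hp₀ : 0 < p₀) (hq : p₀ < q) (hab : a < b) :
    Continuous fun ω : TemperedSpace G o p₀ q a b => ω.1 := by
  refine continuous_pi fun x => ?_
  let p : Set.Ico p₀ q := ⟨p₀, le_rfl, hq⟩
  let α : Set.Ioc a b := ⟨b, hab, le_rfl⟩
  have hto : Continuous fun ω : TemperedSpace G o p₀ q a b => ω.toLp p α :=
    continuous_iInf_dom (continuous_iInf_dom continuous_induced_dom)
  suffices h : Continuous fun ω : LpSpace G o p α => ω.1 x from h.comp hto
  refine continuous_iff_continuousAt.2 fun η => Metric.tendsto_nhds.2 fun ε hε => ?_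
  have hwx := weight_pos G o (α : ℝ) x
  -- The summand at `x` alone shows that a distance below this radius forces `|ω x - η x| < ε`.
  set ε' : ℝ := (ε ^ p₀ * weight G o α x) ^ (1 / p₀) with hε'
  have hε'0 : 0 < ε' := by positivity
  have hopen : IsOpen {ω : LpSpace G o p α | lpNorm G o p α (ω.1 - η.1) < ε'} :=
    TopologicalSpace.isOpen_generateFrom_of_mem ⟨η, ε', hε'0, rfl⟩
  have hη : lpNorm G o p α (η.1 - η.1) < ε' := by
    have : lpNorm G o p α (η.1 - η.1) = 0 := by
      simp [lpNorm, p, Real.zero_rpow hp₀.ne', Real.zero_rpow (inv_ne_zero hp₀.ne')]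
    rwa [this]
  filter_upwards [hopen.mem_nhds hη] with ω hω
  have hs := summable_sub hp₀.le ω.2 η.2
  have h1 : |ω.1 x - η.1 x| ^ p₀ * weight G o α x ≤
      ∑' y, |ω.1 y - η.1 y| ^ p₀ * weight G o α y :=
    hs.le_tsum x fun y _ => rpow_mul_weight_nonneg p₀ α (ω.1 - η.1) y
  have h2 : ∑' y, |ω.1 y - η.1 y| ^ p₀ * weight G o α y < ε ^ p₀ * weight G o α x := by
    have h0 : 0 ≤ ∑' y, |ω.1 y - η.1 y| ^ p₀ * weight G o α y :=
      tsum_nonneg fun y => rpow_mul_weight_nonneg p₀ α (ω.1 - η.1) y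
    exact (Real.rpow_lt_rpow_iff h0 (by positivity) (by positivity : 0 < 1 / p₀)).1 hω
  rw [Real.dist_eq]
  exact (Real.rpow_lt_rpow_iff (abs_nonneg _) hε.le hp₀).1
    (lt_of_mul_lt_mul_right (h1.trans_lt h2) hwx.le)

end Topology

/-! ### Transfer of weak convergence along maps continuous on large closed sets -/

section Transfer

variable {E Y : Type*} [TopologicalSpace E] [MeasurableSpace E] [BorelSpace E]
  [TopologicalSpace Y] [MeasurableSpace Y] [BorelSpace Y]

lemma measurable_of_continuousOn_iUnion {K : ℕ → Set E} (hK : ∀ n, IsClosed (K n)) {φ : E → Y}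
    (hφ : ∀ n, ContinuousOn φ (K n)) {y₀ : Y} (hy₀ : ∀ e ∉ ⋃ n, K n, φ e = y₀) :
    Measurable φ := by
  refine measurable_of_isOpen fun U hU => ?_
  have hS : MeasurableSet (⋃ n, K n) := MeasurableSet.iUnion fun n => (hK n).measurableSet
  have h1 : ∀ n, MeasurableSet (φ ⁻¹' U ∩ K n) := fun n => by
    obtain ⟨u, hu, he⟩ := continuousOn_iff'.1 (hφ n) U hU
    rw [he]
    exact hu.measurableSet.inter (hK n).measurableSet
  have h2 : MeasurableSet (φ ⁻¹' U ∩ (⋃ n, K n)ᶜ) := by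
    by_cases hy : y₀ ∈ U
    · convert hS.compl using 1
      ext e
      simp only [Set.mem_inter_iff, Set.mem_preimage, Set.mem_compl_iff, and_iff_right_iff_imp]
      exact fun he => by rw [hy₀ e he]; exact hy
    · convert MeasurableSet.empty using 1
      ext e
      simp only [Set.mem_inter_iff, Set.mem_preimage, Set.mem_compl_iff, Set.mem_empty_iff_false,
        iff_false, not_and, not_not]
      intro he
      by_contra hne
      rw [hy₀ e hne] at he
      exact hy he
  rw [← Set.inter_union_compl (φ ⁻¹' U) (⋃ n, K n), Set.inter_iUnion]
  exact (MeasurableSet.iUnion h1).union h2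

/-- For a bounded continuous `f`, Tietze extends `f ∘ φ` from `K n` to some `g n` with no larger
norm. The integrals of `g n` are weakly continuous in the measure and differ from that of `f ∘ φ` by
at most `2 * ‖f‖ * u n`, so they converge uniformly. -/
lemma continuousOn_probabilityMeasure_map [NormalSpace E] {K : ℕ → Set E}
    (hK : ∀ n, IsClosed (K n)) {φ : E → Y} (hφ : ∀ n, ContinuousOn φ (K n)) (hm : Measurable φ)
    {u : ℕ → NNReal} (hu : Tendsto u atTop (𝓝 0)) :
    ContinuousOn (fun μ : ProbabilityMeasure E => μ.map hm.aemeasurable)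
      {μ | ∀ n, μ (K n)ᶜ ≤ u n} := by
  set A : Set (ProbabilityMeasure E) := {μ | ∀ n, μ (K n)ᶜ ≤ u n}
  have key : ∀ f : BoundedContinuousFunction Y ℝ,
      ContinuousOn (fun μ : ProbabilityMeasure E => ∫ e, f (φ e) ∂(μ : Measure E)) A := by
    intro f
    have hext : ∀ n, ∃ g : BoundedContinuousFunction E ℝ, ‖g‖ ≤ ‖f‖ ∧
        ∀ e ∈ K n, g e = f (φ e) := by
      intro n
      let F : BoundedContinuousFunction (K n) ℝ := f.compContinuous
        ⟨(K n).domRestrict φ, continuousOn_iff_continuous_domRestrict.1 (hφ n)⟩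
      obtain ⟨g, hg, he⟩ := F.exists_norm_eq_domRestrict_eq_of_closed (hK n)
      refine ⟨g, ?_, fun e he' => ?_⟩
      · rw [hg]
        exact (BoundedContinuousFunction.norm_le (norm_nonneg _)).2 fun x => f.norm_coe_le_norm _
      · exact congrArg (fun h : BoundedContinuousFunction (K n) ℝ => h ⟨e, he'⟩) he
    choose g hg hge using hext
    have hfm : Measurable fun e => f (φ e) := f.continuous.measurable.comp hm
    have hunif : TendstoUniformlyOn
        (fun (n : ℕ) (μ : ProbabilityMeasure E) => ∫ e, g n e ∂(μ : Measure E))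
        (fun μ => ∫ e, f (φ e) ∂(μ : Measure E)) atTop A := by
      rw [Metric.tendstoUniformlyOn_iff]
      intro ε hε
      have hlim : Tendsto (fun n => 2 * ‖f‖ * (u n : ℝ)) atTop (𝓝 (2 * ‖f‖ * (0 : ℝ))) :=
        ((NNReal.tendsto_coe.2 hu).const_mul _)
      rw [mul_zero] at hlim
      filter_upwards [hlim.eventually_lt_const hε] with n hn μ hμ
      refine lt_of_le_of_lt ?_ hn
      have hfi : Integrable (fun e => f (φ e)) (μ : Measure E) :=
        Integrable.of_bound hfm.aestronglyMeasurable ‖f‖ (ae_of_all _ fun e =>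
          f.norm_coe_le_norm _)
      have hgi : Integrable (g n) (μ : Measure E) := (g n).integrable _
      have hKm : MeasurableSet (K n)ᶜ := (hK n).measurableSet.compl
      rw [dist_eq_norm, ← integral_sub hfi hgi]
      calc ‖∫ e, (f (φ e) - g n e) ∂(μ : Measure E)‖
          ≤ ∫ e, (K n)ᶜ.indicator (fun _ => 2 * ‖f‖) e ∂(μ : Measure E) := by
            refine norm_integral_le_of_norm_le ((integrable_const _).indicator hKm)
              (ae_of_all _ fun e => ?_)
            by_cases he : e ∈ K n
            · simp [he, hge n e he]
            · rw [Set.indicator_of_mem (by exact he)]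
              have h1 := f.norm_coe_le_norm (φ e)
              have h2 := (g n).norm_coe_le_norm e
              have h3 := norm_sub_le (f (φ e)) (g n e)
              linarith [hg n]
        _ = (μ : Measure E).real (K n)ᶜ * (2 * ‖f‖) := by
            rw [integral_indicator_const _ hKm, smul_eq_mul]
        _ ≤ 2 * ‖f‖ * u n := by
            rw [mul_comm]
            refine mul_le_mul_of_nonneg_left ?_ (by positivity)
            rw [ProbabilityMeasure.measureReal_eq_coe_coeFn]
            exact NNReal.coe_le_coe.2 (hμ n)
    exact hunif.continuousOn (Frequently.of_forall fun n =>
      (ProbabilityMeasure.continuous_integral_boundedContinuousFunction (g n)).continuousOn)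
  intro μ hμ
  refine ProbabilityMeasure.tendsto_iff_forall_integral_tendsto.2 fun f => ?_
  have := key f μ hμ
  simp only [ProbabilityMeasure.toMeasure_map]
  have hmap : ∀ ν : ProbabilityMeasure E, ∫ y, f y ∂(ν : Measure E).map φ =
      ∫ e, f (φ e) ∂(ν : Measure E) := fun ν =>
    integral_map hm.aemeasurable f.continuous.stronglyMeasurable.aestronglyMeasurable
  simp only [hmap]
  exact this

end Transfer

/-! ### Compact sets of configurations given by moment bounds. -/

section Exhaustion

variable {X : Type*} {G : SimpleGraph X} {o : X}

lemma isClosed_setOf_lpModular_le {p α : ℝ} (hp : 0 < p) (c : ℝ≥0∞) :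
    IsClosed {ω : X → ℝ | lpModular G o p α ω ≤ c} := by
  have : LowerSemicontinuous fun ω : X → ℝ => lpModular G o p α ω := by
    refine lowerSemicontinuous_tsum fun x => Continuous.lowerSemicontinuous ?_
    refine ENNReal.continuous_ofReal.comp (Continuous.mul ?_ continuous_const)
    exact (continuous_abs.comp (continuous_apply x)).rpow_const fun _ => Or.inr hp.le
  exact this.isClosed_preimage c

/-- A single modular bound confines each coordinate to a bounded interval; Tychonoff's theorem and
lower semicontinuity do the rest. -/
lemma isCompact_setOf_lpModular_le {p α : ℝ} (hp : 0 < p) (c : NNReal) :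
    IsCompact {ω : X → ℝ | lpModular G o p α ω ≤ c} := by
  set R : X → ℝ := fun x => (c / weight G o α x) ^ (1 / p)
  refine IsCompact.of_isClosed_subset
    (isCompact_univ_pi fun x => isCompact_Icc (a := -R x) (b := R x))
    (isClosed_setOf_lpModular_le hp c) fun ω hω x _ => ?_
  have hw := weight_pos G o α x
  have h1 : ENNReal.ofReal (|ω x| ^ p * weight G o α x) ≤ c :=
    (ENNReal.le_tsum x).trans hω
  rw [ENNReal.ofReal_le_iff_le_toReal ENNReal.coe_ne_top, ENNReal.coe_toReal,
    ← le_div_iff₀ hw] at h1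
  refine abs_le.1 ?_
  have h2 := Real.rpow_le_rpow (by positivity) h1 (by positivity : 0 ≤ 1 / p)
  rwa [← Real.rpow_mul (abs_nonneg _), mul_one_div_cancel hp.ne', Real.rpow_one] at h2

/-- Compact sets that carry most of the mass of all measures with prescribed moment bounds. -/
lemma exists_isCompact_exhaustion [Countable X] {p α : ℕ → ℝ} (hp : ∀ j, 0 < p j)
    (D u : ℕ → NNReal) (hu : ∀ n, 0 < u n) :
    ∃ K : ℕ → Set (X → ℝ), (∀ n, IsCompact (K n)) ∧
      (∀ n j, ∃ N : NNReal, ∀ ω ∈ K n, lpModular G o (p j) (α j) ω ≤ N) ∧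
      ∀ μ : ProbabilityMeasure (X → ℝ),
        (∀ j, ∫⁻ ω, lpModular G o (p j) (α j) ω ∂(μ : Measure (X → ℝ)) ≤ D j) →
        ∀ n, μ (K n)ᶜ ≤ u n := by
  have hε : ∀ n, ∃ ε : ℕ → NNReal, (∀ j, 0 < ε j) ∧ ∑' j, (ε j : ℝ≥0∞) < u n := fun n =>
    ENNReal.exists_pos_sum_of_countable (ENNReal.coe_ne_zero.2 (hu n).ne') ℕ
  choose ε hε0 hεu using hε
  -- With this threshold, Markov's inequality bounds the `j`-th bad set by `ε n j`; the `+ 1` keeps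
  -- the threshold positive when `D j = 0`.
  refine ⟨fun n => ⋂ j, {ω | lpModular G o (p j) (α j) ω ≤ ((D j + 1) / ε n j : NNReal)},
    fun n => ?_, fun n j => ⟨(D j + 1) / ε n j, fun ω hω => Set.mem_iInter.1 hω j⟩,
    fun μ hμ n => ?_⟩
  · exact IsCompact.of_isClosed_subset (isCompact_setOf_lpModular_le (hp 0) _)
      (isClosed_iInter fun j => isClosed_setOf_lpModular_le (hp j) _) (Set.iInter_subset _ 0)
  · rw [← ENNReal.coe_le_coe, ProbabilityMeasure.ennreal_coeFn_eq_coeFn_toMeasure,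
      Set.compl_iInter]
    refine (measure_iUnion_le _).trans ((ENNReal.tsum_le_tsum fun j => ?_).trans (hεu n).le)
    have hne : ((D j + 1) / ε n j : NNReal) ≠ 0 :=
      (div_pos (by positivity) (hε0 n j)).ne'
    calc (μ : Measure (X → ℝ))
          {ω | lpModular G o (p j) (α j) ω ≤ ((D j + 1) / ε n j : NNReal)}ᶜ
        ≤ (μ : Measure (X → ℝ))
          {ω | (((D j + 1) / ε n j : NNReal) : ℝ≥0∞) ≤ lpModular G o (p j) (α j) ω} :=
          measure_mono fun ω hω => by
            simp only [Set.mem_compl_iff, Set.mem_ofPred_eq, not_le] at hω ⊢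
            exact hω.le
      _ ≤ (∫⁻ ω, lpModular G o (p j) (α j) ω ∂(μ : Measure (X → ℝ))) /
          ((D j + 1) / ε n j : NNReal) :=
          meas_ge_le_lintegral_div (measurable_lpModular G o _ _).aemeasurable
            (ENNReal.coe_ne_zero.2 hne) ENNReal.coe_ne_top
      _ ≤ ε n j := by
          refine ENNReal.div_le_of_le_mul ((hμ j).trans ?_)
          rw [← ENNReal.coe_mul, mul_div_cancel₀ _ (hε0 n j).ne']
          exact ENNReal.coe_le_coe.2 (by simp)

end Exhaustion

/-! ### Existence and compactness. -/

section Main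

variable {X : Type*} [Countable X] {G : SimpleGraph X} [G.LocallyFinite] {o : X}
  {W : ℝ → ℝ → ℝ} {V : ℝ → ℝ} {r q I J a c : ℝ}

/-- The DLR equations have a solution in every compact set of measures that contains the local
specifications with zero boundary condition. -/
lemma IsStablePotential.exists_forall_bind_eq (h : IsStablePotential W V r q I J a c) (o : X)
    {A : Set (ProbabilityMeasure (X → ℝ))} (hA : IsCompact A)
    (hmem : ∀ μ : ProbabilityMeasure (X → ℝ), ∀ Λ : Finset X,
      (μ : Measure (X → ℝ)) = gibbsSpec G W V Λ 0 → μ ∈ A) :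
    ∃ μ ∈ A, ∀ Λ : Finset X, (μ : Measure (X → ℝ)).bind (gibbsSpec G W V Λ) = μ := by
  classical
  set C : Finset X → Set (ProbabilityMeasure (X → ℝ)) := fun Λ =>
    A ∩ {μ | (μ : Measure (X → ℝ)).bind (gibbsSpec G W V Λ) = μ} with hC
  have hclosed : ∀ Λ, IsClosed {μ : ProbabilityMeasure (X → ℝ) |
      (μ : Measure (X → ℝ)).bind (gibbsSpec G W V Λ) = μ} := fun Λ =>
    h.isClosed_setOf_bind_eq Λ
  have hanti : ∀ {Λ Δ : Finset X}, Λ ⊆ Δ → C Δ ⊆ C Λ := fun hΛ μ hμ =>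
    ⟨hμ.1, h.bind_eq_of_subset hΛ hμ.2⟩
  have hne : (⋂ Λ, C Λ).Nonempty := by
    refine IsCompact.nonempty_iInter_of_directed_nonempty_isCompact_isClosed C ?_ ?_ ?_ ?_
    · exact fun Λ Δ => ⟨Λ ∪ Δ, hanti Finset.subset_union_left, hanti Finset.subset_union_right⟩
    · intro Λ
      have := h.isProbabilityMeasure_gibbsSpec (G := G) Λ 0
      exact ⟨⟨gibbsSpec G W V Λ 0, this⟩, hmem _ Λ rfl, h.bind_gibbsSpec_bind subset_rfl 0⟩
    · exact fun Λ => hA.inter_right (hclosed Λ)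
    · exact fun Λ => hA.isClosed.inter (hclosed Λ)
  obtain ⟨μ, hμ⟩ := hne
  rw [Set.mem_iInter] at hμ
  exact ⟨μ, (hμ {o}).1, fun Λ => (hμ Λ).2⟩

lemma IsStablePotential.isCompact_temperedGibbsOn (h : IsStablePotential W V r q I J a c)
    (hG : G.Connected) {θ α₀ α₁ : ℝ} (hθ : 0 < θ) (hq : r + r / θ < q) (hα₀ : 0 ≤ α₀)
    (hα : α₀ < α₁) (hΘ : ∀ α ∈ Set.Ioc α₀ α₁, bigTheta G o α θ < ∞) :
    (temperedGibbsOn G o W V (r + r / θ) q α₀ α₁).Nonempty ∧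
      IsCompact (temperedGibbsOn G o W V (r + r / θ) q α₀ α₁) := by
  classical
  have hr := h.r_pos
  set p₀ := r + r / θ with hp₀def
  have hp₀ : 0 < p₀ := by positivity
  have hw : ∀ α ∈ Set.Ioc α₀ α₁, Summable (weight G o α) := fun α hα' => by
    have := ENNReal.summable_toReal (tsum_weight_lt_top hG o hθ (hΘ α hα')).ne
    simpa only [ENNReal.toReal_ofReal (weight_pos G o α _).le] using this
  -- The strict inequalities `p j < q` and `α₀ < α j` keep each pair within reach of the moment
  -- estimate, while every tempered exponent lies strictly below some `p j`.
  obtain ⟨p, -, hpmem, hplim⟩ := exists_seq_strictMono_tendsto' hq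
  obtain ⟨α, -, hαmem, hαlim⟩ := exists_seq_strictAnti_tendsto' hα
  have hpj : ∀ j, 0 < p j := fun j => hp₀.trans (hpmem j).1
  have hαj : ∀ j, α j ∈ Set.Ioc α₀ α₁ := fun j => ⟨(hαmem j).1, (hαmem j).2.le⟩
  have hcof : ∀ s < q, ∀ β > α₀, ∃ j, s < p j ∧ α j ≤ β := fun s hs β hβ =>
    ((hplim.eventually_const_lt hs).and (hαlim.eventually_le_const hβ)).exists
  have hD : ∀ j, ∃ D : NNReal, ∀ (Λ : Finset X) (ξ : X → ℝ),
      ∑ x ∈ Λ, ∫⁻ ω, ENNReal.ofReal (|ω x| ^ p j * weight G o (α j) x) ∂gibbsSpec G W V Λ ξ ≤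
        D + ∑' x : {x // x ∉ Λ}, ENNReal.ofReal (|ξ x| ^ p j * weight G o (α j) x) := fun j =>
    h.exists_sum_lintegral_gibbsSpec_le hG o hθ (hpmem j).1.le (hpmem j).2
      (hα₀.trans (hαj j).1.le) (hΘ _ (hαj j))
  choose D hD using hD
  obtain ⟨u, -, hu0, hulim⟩ := exists_seq_strictAnti_tendsto (0 : NNReal)
  obtain ⟨K, hKc, hKN, hKμ⟩ := exists_isCompact_exhaustion (G := G) (o := o) (α := α) hpj D u hu0
  set S : Set (X → ℝ) := ⋃ n, K n with hS
  have hKcl : ∀ n, IsClosed (K n) := fun n => (hKc n).isClosed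
  have hSm : MeasurableSet S := MeasurableSet.iUnion fun n => (hKcl n).measurableSet
  have htemp : temperedSet G o p₀ q α₀ α₁ = ⋂ j, lpSet G o (p j) (α j) := by
    ext ω
    simp only [temperedSet, Set.mem_iInter]
    refine ⟨fun hω j => hω _ ⟨(hpmem j).1.le, (hpmem j).2⟩ _ (hαj j), fun hω s hs β hβ => ?_⟩
    obtain ⟨j, hj1, hj2⟩ := hcof s hs.2 β hβ.1
    exact mem_lpSet_of_lt (hp₀.trans_le hs.1) hj1 hj2 (hw β hβ) (hω j)
  have hST : ∀ ω ∈ S, ω ∈ temperedSet G o p₀ q α₀ α₁ := by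
    intro ω hω
    rw [htemp]
    obtain ⟨n, hn⟩ := Set.mem_iUnion.1 hω
    refine Set.mem_iInter.2 fun j => mem_lpSet_iff.2 ?_
    obtain ⟨N, hN⟩ := hKN n j
    exact ne_top_of_le_ne_top ENNReal.coe_ne_top (hN ω hn)
  have hlp : ∀ j, MeasurableSet (lpSet G o (p j) (α j)) := fun j => by
    have : lpSet G o (p j) (α j) = {ω | lpModular G o (p j) (α j) ω = ∞}ᶜ := by
      ext ω; exact mem_lpSet_iff
    rw [this]
    exact (measurable_lpModular G o _ _ (measurableSet_singleton ∞)).compl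
  have htm : MeasurableSet (temperedSet G o p₀ q α₀ α₁) := by
    rw [htemp]; exact MeasurableSet.iInter hlp
  have hzero : (0 : X → ℝ) ∈ temperedSet G o p₀ q α₀ α₁ := by
    rw [htemp]
    refine Set.mem_iInter.2 fun j => mem_lpSet_iff.2 ?_
    simp [lpModular, Real.zero_rpow (hpj j).ne']
  -- The value off `S` is arbitrary, since every measure in `A` below is carried by `S`.
  let φ : (X → ℝ) → TemperedSpace G o p₀ q α₀ α₁ := fun ω =>
    if hω : ω ∈ S then ⟨ω, hST ω hω⟩ else ⟨0, hzero⟩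
  have hφS : ∀ ω ∈ S, (φ ω).1 = ω := fun ω hω => by simp [φ, hω]
  have hφc : ∀ n, ContinuousOn φ (K n) := fun n =>
    continuousOn_temperedSpace hp₀ hw (fun s hs β hβ => by
      obtain ⟨j, hj1, hj2⟩ := hcof s hs.2 β hβ.1
      obtain ⟨N, hN⟩ := hKN n j
      exact ⟨p j, hj1, N, fun ω hω => (lpModular_anti hj2 ω).trans (hN ω hω)⟩)
      fun ω hω => hφS ω (Set.mem_iUnion_of_mem n hω)
  have hφm : Measurable φ := measurable_of_continuousOn_iUnion hKcl hφc
    (y₀ := ⟨0, hzero⟩) fun ω hω => dif_neg hω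
  set A : Set (ProbabilityMeasure (X → ℝ)) := {μ | ∀ n, μ (K n)ᶜ ≤ u n} with hA
  -- Prokhorov's theorem: the sets `K n` give tightness uniformly on `A`.
  have hAc : IsCompact A := isCompact_setOfPred_probabilityMeasure_mass_eq_compl_isCompact_le
    hulim hKc (Or.inl inferInstance)
  have hAS : ∀ μ ∈ A, (μ : Measure (X → ℝ)) Sᶜ = 0 := by
    intro μ hμ
    rw [← ProbabilityMeasure.null_iff_toMeasure_null]
    refine le_antisymm (ge_of_tendsto' hulim fun n => ?_) zero_le
    exact (μ.apply_mono (Set.compl_subset_compl.2 (Set.subset_iUnion K n))).trans (hμ n)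
  -- Temperedness may be replaced by membership in `A`: the uniform moment bounds give one
  -- direction, `S ⊆ temperedSet` the other.
  have hgibbs : temperedGibbs G o W V p₀ q α₀ α₁ =
      A ∩ ⋂ (Λ : Finset X) (_ : Λ.Nonempty), {μ : ProbabilityMeasure (X → ℝ) |
        (μ : Measure (X → ℝ)).bind (gibbsSpec G W V Λ) = μ} := by
    ext μ
    simp only [temperedGibbs, Set.mem_inter_iff, Set.mem_iInter, Set.mem_ofPred_eq,
      h.isGibbs_iff μ]
    constructor
    · rintro ⟨hμ, hμt⟩
      refine ⟨hKμ μ fun j => h.lintegral_lpModular_le_of_bind_eq (hD j) hμ ?_, hμ⟩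
      have hae : ∀ᵐ ω ∂(μ : Measure (X → ℝ)), ω ∈ temperedSet G o p₀ q α₀ α₁ :=
        (prob_compl_eq_zero_iff htm).2 hμt
      filter_upwards [hae] with ω hω
      rw [htemp] at hω
      exact mem_lpSet_iff.1 (Set.mem_iInter.1 hω j)
    · rintro ⟨hμA, hμ⟩
      refine ⟨hμ, (prob_compl_eq_zero_iff htm).1 ?_⟩
      exact measure_mono_null (Set.compl_subset_compl.2 hST) (hAS μ hμA)
  have hval : Measurable fun ω : TemperedSpace G o p₀ q α₀ α₁ => ω.1 :=
    (continuous_temperedSpace_val hp₀ hq hα).measurable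
  -- The measures on the tempered space are push-forwards under `φ`, because `φ` almost surely
  -- inverts the inclusion.
  have himage : temperedGibbsOn G o W V p₀ q α₀ α₁ =
      (fun μ : ProbabilityMeasure (X → ℝ) => μ.map hφm.aemeasurable) ''
        temperedGibbs G o W V p₀ q α₀ α₁ := by
    ext ν
    constructor
    · rintro ⟨μ, hμ, hνμ⟩
      have hμS : (μ : Measure (X → ℝ)) Sᶜ = 0 := hAS μ (by rw [hgibbs] at hμ; exact hμ.1)
      refine ⟨μ, hμ, Subtype.ext ?_⟩
      have hmap : (ν : Measure (TemperedSpace G o p₀ q α₀ α₁)).map (fun ω => ω.1) = μ := by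
        ext B hB
        rw [Measure.map_apply hval hB]
        exact hνμ B hB
      have hae : ∀ᵐ ω ∂(ν : Measure (TemperedSpace G o p₀ q α₀ α₁)), φ ω.1 = ω := by
        have : (ν : Measure (TemperedSpace G o p₀ q α₀ α₁)) {ω | ω.1 ∈ Sᶜ} = 0 := by
          rw [hνμ _ hSm.compl, hμS]
        have hS' : ∀ᵐ ω ∂(ν : Measure (TemperedSpace G o p₀ q α₀ α₁)), ω.1 ∈ S := this
        filter_upwards [hS'] with ω hω
        exact Subtype.ext (hφS ω.1 hω)
      change (μ : Measure (X → ℝ)).map φ = (ν : Measure (TemperedSpace G o p₀ q α₀ α₁))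
      rw [← hmap, Measure.map_map hφm hval]
      exact (Measure.map_congr hae).trans Measure.map_id
    · rintro ⟨μ, hμ, rfl⟩
      have hμS : (μ : Measure (X → ℝ)) Sᶜ = 0 := hAS μ (by rw [hgibbs] at hμ; exact hμ.1)
      refine ⟨μ, hμ, fun B hB => ?_⟩
      refine (Measure.map_apply hφm (hval hB)).trans (measure_congr ?_)
      have hae : ∀ᵐ ω ∂(μ : Measure (X → ℝ)), ω ∈ S := hμS
      filter_upwards [hae] with ω hω
      exact congrArg B (hφS ω hω)
  rw [himage, hgibbs]
  constructor
  · refine Set.Nonempty.image _ ?_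
    obtain ⟨μ, hμA, hμ⟩ := h.exists_forall_bind_eq (G := G) o hAc fun μ Λ hμ =>
      hKμ μ fun j => by
        rw [hμ]
        exact h.lintegral_lpModular_gibbsSpec_zero_le (hpj j) (hD j) Λ
    exact ⟨μ, hμA, Set.mem_iInter₂.2 fun Λ _ => hμ Λ⟩
  · refine (hAc.inter_right (isClosed_biInter fun Λ _ =>
      h.isClosed_setOf_bind_eq Λ)).image_of_continuousOn ?_
    exact (continuousOn_probabilityMeasure_map hKcl hφc hφm hulim).mono Set.inter_subset_left

end Main

end GibbsGraph

theorem theorem3p2 {X : Type*} [Countable X] (G : SimpleGraph X) [G.LocallyFinite]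
    (hG : G.Connected) (o : X)
    (W : ℝ → ℝ → ℝ) (V : ℝ → ℝ) (θ r q I_W J_W a_V c_V αbar : ℝ)
    (hθ : 0 < θ) (hΘ : ∃ α : ℝ, 0 < α ∧ GibbsGraph.bigTheta G o α θ < ∞)
    (hWcont : Continuous (Function.uncurry W)) (hWsymm : ∀ s t : ℝ, W s t = W t s)
    (hr : 0 < r) (hI : 0 < I_W) (hJ : 0 < J_W)
    (hW : ∀ s t : ℝ, |W s t| ≤ (I_W + J_W * (|s| ^ r + |t| ^ r)) / 2)
    (hVcont : Continuous V) (ha : 0 < a_V) (hc : 0 < c_V) (hq : r + r / θ < q)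
    (hV : ∀ s : ℝ, a_V * |s| ^ q - c_V ≤ V s)
    (hαbar : GibbsGraph.alphaLower G o θ < αbar)
    (hαbarΘ : ∀ α ∈ Set.Ioc (GibbsGraph.alphaLower G o θ) αbar,
      GibbsGraph.bigTheta G o α θ < ∞) :
    (GibbsGraph.temperedGibbsOn G o W V (r + r / θ) q
        (GibbsGraph.alphaLower G o θ) αbar).Nonempty ∧
      IsCompact (GibbsGraph.temperedGibbsOn G o W V (r + r / θ) q
        (GibbsGraph.alphaLower G o θ) αbar) := by
  have hlt : r < q := by
    have : 0 < r / θ := div_pos hr hθ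
    linarith
  exact GibbsGraph.IsStablePotential.isCompact_temperedGibbsOn
    ⟨hWcont, hWsymm, hr, hI, hJ, ha, hc, hlt, hW, hVcont, hV⟩ hG hθ hq
    -- Non-negativity of the lower endpoint makes every admissible `α` non-negative, as the
    -- comparison of adjacent weights requires.
    (Real.sInf_nonneg fun _ h => h.1.le) hαbar hαbarΘ
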